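/- Let $K:(0,\infty)^2\to\mathbb{C}$ be a smooth (i.e. $C^\infty$) kernel such that for every $s>0$ there is $\beta<\tfrac12$ with \[ (x\partial_x)^i(y\partial_y)^j K(x,y)=O\big((xy)^{-\beta}\big)\quad\text{on }(0,s)^2,\qquad i+j\le 3 \] (this holds, with $\beta=0$, if $K$ is $C^\infty$ up to the boundary on $[0,\infty)^2$, and, with $\beta=-\alpha/2$, for the Bessel kernel of parameter $\alpha>-1$). Such a $K$ induces an integral operator on $L^2(0,s)$ for all $s>0$, also denoted by $K$. Define the derived kernel \[ K'(x,y):=K(x,y)+xK_x(x,y)+yK_y(x,y), \] and $K'':=(K')'$, and denote by \[ g(s)=\det(I-K)|_{L^2(0,s)}=\sum_{n=0}^\infty\frac{(-1)^n}{n!}\int_{(0,s)^n}\det\big(K(x_i,x_j)\big)_{i,j=1}^n\,dx_1\cdots dx_n \] the Fredholm determinant. Assume that $g(s)$ is real and $g(s)>0$ for all $s>0$. Then, for every $s>0$: the kernels $K,K',K''$ induce bounded integral operators on $L^2(0,s)$, $I-K$ is invertible on $L^2(0,s)$, the function $g$ and the function $v(s):=-s\frac{d}{ds}\log g(s)$ are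 differentiable at $s$, the operators below are of trace class on $L^2(0,s)$, and \begin{align*} v(s)&=-s\frac{d}{ds}\log g(s)=\operatorname{tr}\big((I-K)^{-1}K'\big)|_{L^2(0,s)},\\ u(s)&:=s\,v'(s)=\operatorname{tr}\big((I-K)^{-1}K''+((I-K)^{-1}K')^2\big)|_{L^2(0,s)}. \end{align*} -/

import Mathlib

open MeasureTheory Set
open scoped ContDiff

noncomputable section

namespace DerivedKernel

/-- The complex Hilbert space `L²(0,s)`. -/
abbrev L2 (s : ℝ) : Type := Lp ℂ 2 (volume.restrict (Ioo (0 : ℝ) s))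

/-- The Euler derivative `x ∂ₓ F` in the first variable. -/
def eulerX (F : ℝ → ℝ → ℂ) (x y : ℝ) : ℂ := (x : ℂ) * deriv (fun t => F t y) x

/-- The Euler derivative `y ∂ᵧ F` in the second variable. -/
def eulerY (F : ℝ → ℝ → ℂ) (x y : ℝ) : ℂ := (y : ℂ) * deriv (fun t => F x t) y

/-- The derived kernel `K' = K + x Kₓ + y Kᵧ`. -/
def derived (K : ℝ → ℝ → ℂ) (x y : ℝ) : ℂ := K x y + eulerX K x y + eulerY K x y

/-- A smooth kernel: `K` is `C^∞` on the open quadrant `(0,∞)²` and, on each square `(0,s)²`,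
its Euler derivatives `(x ∂ₓ)ⁱ (y ∂ᵧ)ʲ K` of order at most three are bounded by a multiple of
`(x y)^(-β)` for some `β < 1/2`.
Kernels that are `C^∞` up to the boundary, on `[0,∞)²`, have this property with `β = 0`. The Bessel
kernel with parameter `α > -1`, which is `(x y)^(α/2)` times an entire function of `(x, y)`, has it
with `β = -α/2`. -/
structure IsSmoothKernel (K : ℝ → ℝ → ℂ) : Prop where
  contDiffOn : ContDiffOn ℝ ∞ (fun p : ℝ × ℝ => K p.1 p.2) (Ioi 0 ×ˢ Ioi 0)
  bound : ∀ s : ℝ, 0 < s → ∃ β : ℝ, β < 1 / 2 ∧ ∀ i j : ℕ, i + j ≤ 3 → ∃ C : ℝ,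
    ∀ x ∈ Ioo 0 s, ∀ y ∈ Ioo 0 s, ‖(eulerX^[i] (eulerY^[j] K)) x y‖ ≤ C * (x * y) ^ (-β)

/-- The bounded operator `T` on `L²(0,s)` is the integral operator with kernel `K`:
`(T f)(x) = ∫₀ˢ K(x,y) f(y) dy` for almost every `x`, with absolutely convergent integrals. -/
def IsIntegralOperator (K : ℝ → ℝ → ℂ) (s : ℝ) (T : L2 s →L[ℂ] L2 s) : Prop :=
  ∀ f : L2 s, ∀ᵐ x ∂(volume.restrict (Ioo (0 : ℝ) s)),
    IntegrableOn (fun y => K x y * f y) (Ioo 0 s) ∧ T f x = ∫ y in Ioo 0 s, K x y * f y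

/-- Fredholm's determinant `det(I - K)` on `L²(0,s)`:
`∑ₙ (-1)ⁿ/n! ∫_{(0,s)ⁿ} det (K(xᵢ,xⱼ)) dx`. -/
def fredholmDet (K : ℝ → ℝ → ℂ) (s : ℝ) : ℂ :=
  ∑' n : ℕ, ((-1 : ℂ) ^ n / (n.factorial : ℂ)) *
    ∫ x in Set.univ.pi (fun _ : Fin n => Ioo (0 : ℝ) s),
      (Matrix.of (fun i j : Fin n => K (x i) (x j))).det

/-- `T` is of trace class on the complex Hilbert space `H`, with trace `c`: with respect to every
orthonormal basis the diagonal of `T` is (absolutely) summable, with sum `c`. On a complex Hilbert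
space, summability of the diagonal in every orthonormal basis is equivalent to `T` being of
trace class. -/
def HasTrace {H : Type} [NormedAddCommGroup H] [InnerProductSpace ℂ H]
    (T : H →L[ℂ] H) (c : ℂ) : Prop :=
  ∀ (ι : Type) (e : HilbertBasis ι ℂ H), HasSum (fun i => inner ℂ (e i) (T (e i))) c

/-- `v(s) = - s (d/ds) log g(s)`. -/
def auxV (g : ℝ → ℝ) (s : ℝ) : ℝ := -s * deriv (fun t => Real.log (g t)) s

/-- `u(s) = s v'(s)`. -/
def auxU (g : ℝ → ℝ) (s : ℝ) : ℝ := s * deriv (auxV g) s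

end DerivedKernel

end

noncomputable section

/-! ### Hadamard's inequality and bordered determinants -/

namespace DerivedKernel

/-! The interval is frozen and the kernel moves instead. Substituting x = tz identifies the
determinant on (0,ts) with that of the dilated kernel K_t(x,y) = t K(tx,ty) on the fixed interval
(0,s) (`fredholmDet_mul`). Thus s d/ds becomes d/dt at t = 1, and since d/dt [t K(tx,ty)] =
K'(tx,ty), the derived kernel is the velocity of this family (`SmoothQ.hasDerivAt_dilation`).

On the fixed interval, Fredholm's classical theory applies. All kernels are bounded by C w(x) w(y)
with w square integrable, here w(x) = x^(-γ) with γ < 1/2, and Hadamard's inequality makes the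
series for the determinant and the first minor converge with bounds depending only on C and w.
Differentiating a determinant row by row replaces one row by the kernel H = dK_t/dt, so the
derivative of the Fredholm determinant is minus the diagonal integral of the minor whose first row
is taken from H (`hasDerivAt_fredDet`). Expanding that minor along its first row gives the equation
`fredMinor_eq`. When the determinant is nonzero, dividing by it produces the resolvent kernel R with
(1 - K)⁻¹ = 1 + R, and the first formula in the form v = tr(K' + K'R).

For the second formula, v is differentiated once more in t. The identity R₂ - R₁ = (1 + R₂)(K₂ -
K₁)(1 + R₁) gives the derivative (1 + R)K'(1 + R) of the resolvent kernel (`KDeriv.resolvent`), and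
the product rule then gives tr((1 + R)K'') + tr(K'(1 + R)K'(1 + R)).

It remains to identify diagonal integrals with operator traces. For a product of two dominated
kernels this is Parseval's identity under the integral sign (`IsKerOp.hasTrace_mul`). A single
smooth kernel is written as a difference of two such products by integrating its Euler derivative in
x (`IsKerOp.hasTrace_cutK`). This costs one further derivative, so two for K'' and one for its trace
account for the order three in the hypothesis. -/

open Matrix ComplexOrder in
/-- Hadamard's determinant inequality, for a matrix with entries of modulus at most one. -/
theorem norm_det_le_sqrt {n : ℕ} (M : Matrix (Fin n) (Fin n) ℂ) (hM : ∀ i j, ‖M i j‖ ≤ 1) :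
    ‖M.det‖ ≤ Real.sqrt ((n : ℝ) ^ n) := by
  rcases Nat.eq_zero_or_pos n with rfl | hn
  · simp
  have hn' : (0 : ℝ) < n := by exact_mod_cast hn
  have hP : (M * Mᴴ).PosSemidef := posSemidef_self_mul_conjTranspose M
  have hdet : ((‖M.det‖ ^ 2 : ℝ) : ℂ) = ((∏ i, hP.1.eigenvalues i : ℝ) : ℂ) := by
    rw [Complex.ofReal_prod]
    have := hP.1.det_eq_prod_eigenvalues
    rw [det_mul, det_conjTranspose] at this
    rw [← Complex.normSq_eq_norm_sq, ← Complex.mul_conj]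
    exact this
  have htr : ((∑ i, hP.1.eigenvalues i : ℝ) : ℂ) = ((∑ i, ∑ j, ‖M i j‖ ^ 2 : ℝ) : ℂ) := by
    have := hP.1.trace_eq_sum_eigenvalues
    push_cast
    refine this.symm.trans ?_
    rw [trace]
    refine Finset.sum_congr rfl fun i _ => ?_
    rw [diag_apply, mul_apply]
    refine Finset.sum_congr rfl fun j _ => ?_
    rw [conjTranspose_apply, Complex.star_def, Complex.mul_conj, Complex.normSq_eq_norm_sq]
    push_cast; rfl
  have hdet' : ‖M.det‖ ^ 2 = ∏ i, hP.1.eigenvalues i := by exact_mod_cast hdet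
  have htr' : ∑ i, hP.1.eigenvalues i ≤ (n : ℝ) * n := by
    have h1 : ∑ i, hP.1.eigenvalues i = ∑ i, ∑ j, ‖M i j‖ ^ 2 := by exact_mod_cast htr
    rw [h1]
    calc ∑ i, ∑ j, ‖M i j‖ ^ 2 ≤ ∑ _i : Fin n, ∑ _j : Fin n, (1 : ℝ) :=
          Finset.sum_le_sum fun i _ => Finset.sum_le_sum fun j _ =>
            pow_le_one₀ (norm_nonneg _) (hM i j)
      _ = n * n := by simp
  have hev : ∀ i, 0 ≤ hP.1.eigenvalues i := hP.eigenvalues_nonneg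
  -- The eigenvalues of M Mᴴ have product |det M|² and sum at most n², so the arithmetic-geometric
  -- mean inequality bounds their geometric mean by n.
  have hamgm := Real.geom_mean_le_arith_mean_weighted Finset.univ (fun _ : Fin n => (n : ℝ)⁻¹)
    hP.1.eigenvalues (fun _ _ => by positivity) (by simp [hn'.ne']) (fun i _ => hev i)
  rw [← Finset.mul_sum] at hamgm
  have h2 : ∏ i, hP.1.eigenvalues i = (∏ i, hP.1.eigenvalues i ^ ((n : ℝ)⁻¹)) ^ n := by
    rw [← Finset.prod_pow]
    refine Finset.prod_congr rfl fun i _ => ?_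
    rw [Real.rpow_inv_natCast_pow (hev i) hn.ne']
  have h3 : ‖M.det‖ ^ 2 ≤ (n : ℝ) ^ n := by
    rw [hdet', h2]
    refine pow_le_pow_left₀ (Finset.prod_nonneg fun i _ => Real.rpow_nonneg (hev i) _) ?_ n
    refine hamgm.trans ?_
    calc (n : ℝ)⁻¹ * ∑ i, hP.1.eigenvalues i ≤ (n : ℝ)⁻¹ * (n * n) := by gcongr
      _ = n := by field_simp
  exact Real.le_sqrt_of_sq_le h3

/-- Hadamard's determinant inequality, for a matrix dominated by a rank one matrix. -/
theorem norm_det_le {n : ℕ} (M : Matrix (Fin n) (Fin n) ℂ) (C : ℝ) (a b : Fin n → ℝ)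
    (hC : 0 < C) (ha : ∀ i, 0 < a i) (hb : ∀ i, 0 < b i) (hM : ∀ i j, ‖M i j‖ ≤ C * a i * b j) :
    ‖M.det‖ ≤ Real.sqrt ((n : ℝ) ^ n) * C ^ n * (∏ i, a i) * ∏ i, b i := by
  set N : Matrix (Fin n) (Fin n) ℂ := Matrix.of fun i j => M i j / ((C * a i * b j : ℝ) : ℂ)
  have hpos : ∀ i j, 0 < C * a i * b j := fun i j => mul_pos (mul_pos hC (ha i)) (hb j)
  have hN : ‖N.det‖ ≤ Real.sqrt ((n : ℝ) ^ n) := by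
    refine norm_det_le_sqrt N fun i j => ?_
    simp only [N, Matrix.of_apply, norm_div, Complex.norm_real, Real.norm_of_nonneg (hpos i j).le]
    exact (div_le_one (hpos i j)).2 (hM i j)
  have hMN : M = Matrix.of fun i j => ((C * a i : ℝ) : ℂ) *
      (Matrix.of fun i j => (b j : ℂ) * N i j) i j := by
    ext i j
    have : ((C * a i * b j : ℝ) : ℂ) ≠ 0 := by exact_mod_cast (hpos i j).ne'
    simp only [N, Matrix.of_apply]
    push_cast at this ⊢
    rw [← mul_div_assoc, ← mul_div_assoc, ← mul_assoc, mul_div_cancel_left₀ _ this]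
  rw [hMN, Matrix.det_mul_column, Matrix.det_mul_row, norm_mul, norm_mul, norm_prod, norm_prod]
  have h1 : ∏ i, ‖((C * a i : ℝ) : ℂ)‖ = C ^ n * ∏ i, a i := by
    rw [← Fin.prod_const, ← Finset.prod_mul_distrib]
    refine Finset.prod_congr rfl fun i _ => ?_
    rw [Complex.norm_real, Real.norm_of_nonneg (mul_pos hC (ha i)).le]
  have h2 : ∏ i, ‖(b i : ℂ)‖ = ∏ i, b i := Finset.prod_congr rfl fun i _ => by
    rw [Complex.norm_real, Real.norm_of_nonneg (hb i).le]
  rw [h1, h2]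
  have ha' : 0 ≤ ∏ i, a i := Finset.prod_nonneg fun i _ => (ha i).le
  have hb' : 0 ≤ ∏ i, b i := Finset.prod_nonneg fun i _ => (hb i).le
  calc C ^ n * (∏ i, a i) * ((∏ i, b i) * ‖N.det‖)
      ≤ C ^ n * (∏ i, a i) * ((∏ i, b i) * Real.sqrt ((n : ℝ) ^ n)) := by gcongr
    _ = _ := by ring

variable {X : Type*}

/-- The matrix `K(zᵢ, zⱼ)`. -/
def kerMat (K : X → X → ℂ) {n : ℕ} (z : Fin n → X) : Matrix (Fin n) (Fin n) ℂ :=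
  Matrix.of fun i j => K (z i) (z j)

/-- The matrix with rows indexed by `x, z₁, …, zₙ` and columns indexed by `y, z₁, …, zₙ`, whose
entries are given by the kernel `H` in the first row and by the kernel `K` in the other rows. -/
def borderMat (H K : X → X → ℂ) {n : ℕ} (x y : X) (z : Fin n → X) :
    Matrix (Fin (n + 1)) (Fin (n + 1)) ℂ :=
  Matrix.of (Matrix.vecCons (fun j => H x (Matrix.vecCons y z j))
    (fun i j => K (z i) (Matrix.vecCons y z j)))

theorem borderMat_self (K : X → X → ℂ) {n : ℕ} (x y : X) (z : Fin n → X) :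
    borderMat K K x y z =
      Matrix.of fun i j => K (Matrix.vecCons x z i) (Matrix.vecCons y z j) := by
  ext i j
  refine Fin.cases ?_ (fun i => ?_) i <;> simp [borderMat]

/-- Moving the entry j to the front is a cycle of known sign; this is what turns cofactors into
bordered determinants. -/
theorem vecCons_succAbove {n : ℕ} (z : Fin (n + 1) → X) (j i : Fin (n + 1)) :
    Matrix.vecCons (z j) (fun k => z (j.succAbove k)) i = z (j.cycleRange.symm i) := by
  refine Fin.cases ?_ (fun i => ?_) i
  · simp
  · simp [Fin.cycleRange_symm_succ]

/-- Expansion of a bordered determinant along its first row. -/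
theorem det_borderMat_succ (H K : X → X → ℂ) {n : ℕ} (x y : X) (z : Fin (n + 1) → X) :
    (borderMat H K x y z).det = H x y * (kerMat K z).det -
      ∑ j, H x (z j) * (borderMat K K (z j) y fun k => z (j.succAbove k)).det := by
  rw [Matrix.det_succ_row_zero, Fin.sum_univ_succ, sub_eq_add_neg, ← Finset.sum_neg_distrib]
  congr 1
  · simp only [Fin.val_zero, pow_zero, one_mul, borderMat, Matrix.of_apply, Matrix.cons_val_zero]
    congr 2
  · refine Finset.sum_congr rfl fun j _ => ?_
    -- The cofactor matrix has its rows in the order of z; the cycle bringing row j to the top has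
    -- sign (-1)^j. Together with the cofactor sign (-1)^(j+1) this leaves -1 for every j.
    have h1 : (borderMat K K (z j) y fun k => z (j.succAbove k)) =
        ((borderMat H K x y z).submatrix Fin.succ j.succ.succAbove).submatrix
          j.cycleRange.symm id := by
      rw [borderMat_self]
      ext i k
      simp only [Matrix.of_apply, Matrix.submatrix_apply, borderMat, Matrix.cons_val_succ, id]
      rw [vecCons_succAbove]
      congr 1
      refine Fin.cases ?_ (fun k => ?_) k
      · simp
      · simp
    rw [h1, Matrix.det_permute, Equiv.Perm.sign_symm, Fin.sign_cycleRange]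
    simp only [borderMat, Matrix.of_apply, Matrix.cons_val_zero, Matrix.cons_val_succ, Fin.val_succ,
      pow_succ]
    push_cast
    have h2 : ((-1 : ℂ) ^ (j : ℕ)) * (-1) ^ (j : ℕ) = 1 := by
      rw [← mul_pow]; simp
    ring_nf

/-- Replacing the `i`-th row of `K(zᵢ, zⱼ)` by that of `H` gives a bordered determinant. -/
theorem det_updateRow_kerMat (H K : X → X → ℂ) {n : ℕ} (z : Fin (n + 1) → X) (i : Fin (n + 1)) :
    ((kerMat K z).updateRow i fun j => H (z i) (z j)).det =
      (borderMat H K (z i) (z i) fun k => z (i.succAbove k)).det := by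
  rw [← Matrix.det_submatrix_equiv_self i.cycleRange.symm]
  congr 1
  ext a b
  have hb := vecCons_succAbove z i b
  refine Fin.cases ?_ (fun a => ?_) a
  · simp [borderMat, hb]
  · simp [borderMat, hb, Fin.cycleRange_symm_succ, kerMat]

theorem kerMat_transpose (K : X → X → ℂ) {n : ℕ} (z : Fin n → X) :
    kerMat (fun x y => K y x) z = (kerMat K z).transpose := rfl

theorem borderMat_transpose (K : X → X → ℂ) {n : ℕ} (x y : X) (z : Fin n → X) :
    borderMat (fun x y => K y x) (fun x y => K y x) x y z = (borderMat K K y x z).transpose := by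
  rw [borderMat_self, borderMat_self]; rfl

theorem borderMat_zero (H K : X → X → ℂ) (x y : X) (z : Fin 0 → X) :
    (borderMat H K x y z).det = H x y := by
  simp [borderMat]

/-- The derivative of `det K_t(zᵢ, zⱼ)` in a parameter `t`. -/
theorem hasDerivAt_det_kerMat (K : ℝ → X → X → ℂ) (K' : X → X → ℂ) (t : ℝ)
    (h : ∀ x y, HasDerivAt (fun t => K t x y) (K' x y) t) {n : ℕ} (z : Fin (n + 1) → X) :
    HasDerivAt (fun t => (kerMat (K t) z).det)
      (∑ i, (borderMat K' (K t) (z i) (z i) fun k => z (i.succAbove k)).det) t := by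
  have h1 : HasDerivAt (F := Fin (n + 1) → Fin (n + 1) → ℂ) (fun t i j => K t (z i) (z j))
      (fun i j => K' (z i) (z j)) t :=
    (hasDerivAt_pi (E' := fun _ : Fin (n + 1) => Fin (n + 1) → ℂ)).2
      fun i => hasDerivAt_pi.2 fun j => h _ _
  -- The determinant is multilinear in the rows, so its derivative is a sum over the replaced row;
  -- scalars are restricted because the parameter t is real.
  let D : ContinuousMultilinearMap ℝ (fun _ : Fin (n + 1) => Fin (n + 1) → ℂ) ℂ :=
    { toMultilinearMap :=
        ((Matrix.detRowAlternating (R := ℂ) (n := Fin (n + 1))).toMultilinearMap.restrictScalars ℝ)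
      cont := by
        change Continuous fun M : Matrix (Fin (n + 1)) (Fin (n + 1)) ℂ => M.det
        exact Continuous.matrix_det continuous_id }
  have h2 := (D.hasFDerivAt _).comp_hasDerivAt t h1
  refine HasDerivAt.congr_deriv (f := fun t => (kerMat (K t) z).det) h2 ?_
  rw [ContinuousMultilinearMap.linearDeriv_apply]
  refine Finset.sum_congr rfl fun i _ => ?_
  rw [← det_updateRow_kerMat]
  rfl

end DerivedKernel

/-! ### Dominated kernels and the integrals of their determinants -/

namespace DerivedKernel

/-- Hadamard's constant `n^{n/2}`. -/
def hadamardConst (n : ℕ) : ℝ := Real.sqrt ((n : ℝ) ^ n)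

theorem hadamardConst_nonneg (n : ℕ) : 0 ≤ hadamardConst n := Real.sqrt_nonneg _

/-- The factor n^(n/2) is about the square root of n! up to a geometric factor, so dividing by n!
still leaves superexponential decay. The shifted index is the size of a determinant with one border
row and column. -/
theorem summable_hadamard (C W : ℝ) (hC : 0 ≤ C) (hW : 0 ≤ W) :
    Summable fun n : ℕ => hadamardConst (n + 1) * C ^ (n + 1) * W ^ n / n.factorial := by
  set a := C * (W + 1)
  have ha : 0 ≤ a := by positivity
  -- The square of each term is at most p q, with p and q the two summands here, hence the term is
  -- at most p + q. In the factor 8 = 4 · 2, the 4 absorbs m² from n! = m!/m and the 2 compensates q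
  -- = 2^(-m).
  have hs : Summable fun m : ℕ => (8 * Real.exp 1 * a ^ 2) ^ m / m.factorial + (1 / 2 : ℝ) ^ m :=
    (Real.summable_pow_div_factorial _).add (summable_geometric_of_lt_one (by norm_num) (by norm_num))
  refine Summable.of_nonneg_of_le (fun n => ?_) (fun n => ?_) ((summable_nat_add_iff 1).2 hs)
  · have := hadamardConst_nonneg (n + 1)
    positivity
  set m := n + 1 with hm
  have hmf : (m.factorial : ℝ) = m * n.factorial := by
    rw [hm, Nat.factorial_succ]; push_cast; rfl
  have hnf : (0 : ℝ) < n.factorial := by exact_mod_cast n.factorial_pos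
  have hm0 : (0 : ℝ) < m := by positivity
  have h1 : (m : ℝ) ^ m ≤ Real.exp 1 ^ m * m.factorial := by
    have := Real.pow_div_factorial_le_exp (m : ℝ) hm0.le m
    rw [div_le_iff₀ (by positivity)] at this
    rwa [← Real.exp_nat_mul, mul_one]
  have h2 : C ^ m * W ^ n ≤ a ^ m := by
    have : W ^ n ≤ (W + 1) ^ m := by
      calc W ^ n ≤ (W + 1) ^ n := by gcongr; linarith
        _ ≤ (W + 1) ^ m := pow_le_pow_right₀ (by linarith) (by omega)
    rw [mul_pow]; gcongr
  have h3 : (m : ℝ) ^ 2 ≤ 4 ^ m := by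
    have : (m : ℝ) ≤ 2 ^ m := by exact_mod_cast m.lt_two_pow_self.le
    calc (m : ℝ) ^ 2 ≤ (2 ^ m) ^ 2 := by gcongr
      _ = 4 ^ m := by rw [← pow_mul, mul_comm, pow_mul]; norm_num
  have hp : 0 ≤ (8 * Real.exp 1 * a ^ 2) ^ m / (m.factorial : ℝ) := by positivity
  have hq : (0 : ℝ) ≤ (1 / 2) ^ m := by positivity
  have key : (hadamardConst m * C ^ m * W ^ n / n.factorial) ^ 2 ≤
      (8 * Real.exp 1 * a ^ 2) ^ m / m.factorial * (1 / 2) ^ m := by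
    have e1 : (hadamardConst m * C ^ m * W ^ n / n.factorial) ^ 2 =
        (m : ℝ) ^ m * (C ^ m * W ^ n) ^ 2 / (n.factorial : ℝ) ^ 2 := by
      rw [div_pow, mul_assoc, mul_pow, hadamardConst, Real.sq_sqrt (by positivity)]
    have e2 : (8 * Real.exp 1 * a ^ 2) ^ m / m.factorial * (1 / 2) ^ m =
        (Real.exp 1 ^ m * m.factorial) * (a ^ m) ^ 2 * 4 ^ m / (m.factorial : ℝ) ^ 2 := by
      have : (8 : ℝ) ^ m = 4 ^ m * 2 ^ m := by rw [← mul_pow]; norm_num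
      rw [mul_pow, mul_pow, this, div_pow, one_pow, ← pow_mul, ← pow_mul, mul_comm 2 m]
      have : (m.factorial : ℝ) ≠ 0 := by positivity
      field_simp
    rw [e1, e2, div_le_div_iff₀ (by positivity) (by positivity), hmf]
    calc (m : ℝ) ^ m * (C ^ m * W ^ n) ^ 2 * (m * n.factorial) ^ 2
        = (m : ℝ) ^ m * (C ^ m * W ^ n) ^ 2 * (m : ℝ) ^ 2 * (n.factorial : ℝ) ^ 2 := by ring
      _ ≤ (Real.exp 1 ^ m * m.factorial) * (a ^ m) ^ 2 * 4 ^ m * (n.factorial : ℝ) ^ 2 := by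
          gcongr
      _ = _ := by rw [hmf]
  nlinarith [sq_nonneg ((8 * Real.exp 1 * a ^ 2) ^ m / (m.factorial : ℝ) - (1 / 2) ^ m)]

variable {X : Type*} [MeasurableSpace X]

/-- A positive square integrable weight. -/
structure IsWeight (ν : Measure X) (w : X → ℝ) : Prop where
  measurable : Measurable w
  pos : ∀ x, 0 < w x
  integrable : Integrable (fun x => w x ^ 2) ν

/-- A measurable kernel dominated by `C w(x) w(y)`. -/
structure Dominated (w : X → ℝ) (C : ℝ) (K : X → X → ℂ) : Prop where
  pos : 0 < C
  measurable : Measurable fun p : X × X => K p.1 p.2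
  bound : ∀ x y, ‖K x y‖ ≤ C * w x * w y

theorem Dominated.mono {w : X → ℝ} {C C' : ℝ} {K : X → X → ℂ} (hw : ∀ x, 0 < w x)
    (h : Dominated w C K) (hC : C ≤ C') : Dominated w C' K where
  pos := h.pos.trans_le hC
  measurable := h.measurable
  bound x y := (h.bound x y).trans (by have := hw x; have := hw y; gcongr)

theorem Dominated.transpose {w : X → ℝ} {C : ℝ} {K : X → X → ℂ} (h : Dominated w C K) :
    Dominated w C (fun x y => K y x) where
  pos := h.pos
  measurable := h.measurable.comp measurable_swap
  bound x y := (h.bound y x).trans_eq (by ring)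

theorem measurable_det_borderMat {H K : X → X → ℂ} (hH : Measurable fun p : X × X => H p.1 p.2)
    (hK : Measurable fun p : X × X => K p.1 p.2) (n : ℕ) :
    Measurable fun p : (X × X) × (Fin n → X) => (borderMat H K p.1.1 p.1.2 p.2).det := by
  simp only [Matrix.det_apply]
  refine Finset.measurable_sum _ fun σ _ => Measurable.const_smul
    (Finset.measurable_prod _ fun i _ => ?_) _
  have hcol : ∀ j : Fin (n + 1), Measurable fun p : (X × X) × (Fin n → X) =>
      Matrix.vecCons p.1.2 p.2 j := by
    intro j
    refine Fin.cases ?_ (fun j => ?_) j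
    · simp only [Matrix.cons_val_zero]; fun_prop
    · simp only [Matrix.cons_val_succ]; fun_prop
  refine Fin.cases ?_ (fun j => ?_) (σ i)
  · simp only [borderMat, Matrix.of_apply, Matrix.cons_val_zero]
    exact hH.comp ((by fun_prop : Measurable fun p : (X × X) × (Fin n → X) => p.1.1).prodMk
      (hcol i))
  · simp only [borderMat, Matrix.of_apply, Matrix.cons_val_succ]
    exact hK.comp ((by fun_prop : Measurable fun p : (X × X) × (Fin n → X) => p.2 j).prodMk
      (hcol i))

theorem measurable_det_kerMat {K : X → X → ℂ} (hK : Measurable fun p : X × X => K p.1 p.2)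
    (n : ℕ) : Measurable fun z : Fin n → X => (kerMat K z).det := by
  simp only [Matrix.det_apply]
  refine Finset.measurable_sum _ fun σ _ => Measurable.const_smul
    (Finset.measurable_prod _ fun i _ => ?_) _
  exact hK.comp (f := fun z : Fin n → X => (z (σ i), z i))
    ((measurable_pi_apply (σ i)).prodMk (measurable_pi_apply i))

section Bounds

variable {w : X → ℝ} {C : ℝ} {H K : X → X → ℂ}

theorem norm_det_kerMat_le (hw : ∀ x, 0 < w x) (hK : Dominated w C K) {n : ℕ} (z : Fin n → X) :
    ‖(kerMat K z).det‖ ≤ hadamardConst n * C ^ n * ∏ i, w (z i) ^ 2 := by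
  refine (norm_det_le _ C (fun i => w (z i)) (fun i => w (z i)) hK.pos (fun _ => hw _)
    (fun _ => hw _) fun i j => hK.bound _ _).trans_eq ?_
  rw [Finset.prod_pow, hadamardConst]; ring

/-- Every z i labels a row and a column and so contributes a square, whereas x labels only a row and
y only a column. -/
theorem norm_det_borderMat_le (hw : ∀ x, 0 < w x) (hH : Dominated w C H) (hK : Dominated w C K)
    {n : ℕ} (x y : X) (z : Fin n → X) :
    ‖(borderMat H K x y z).det‖ ≤
      hadamardConst (n + 1) * C ^ (n + 1) * w x * w y * ∏ i, w (z i) ^ 2 := by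
  refine (norm_det_le _ C (fun i => w (Matrix.vecCons x z i)) (fun i => w (Matrix.vecCons y z i))
    hK.pos (fun _ => hw _) (fun _ => hw _) fun i j => ?_).trans_eq ?_
  · refine Fin.cases ?_ (fun i => ?_) i
    · exact hH.bound _ _
    · exact hK.bound _ _
  · rw [Fin.prod_univ_succ, Fin.prod_univ_succ, Finset.prod_pow, hadamardConst]
    simp only [Matrix.cons_val_zero, Matrix.cons_val_succ, Nat.succ_eq_add_one]
    generalize Real.sqrt _ = r
    ring

end Bounds

section Integrals

variable (ν : Measure X)

/-- `∫ det K(zᵢ, zⱼ) dz`. -/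
def detInt (K : X → X → ℂ) (n : ℕ) : ℂ :=
  ∫ z, (kerMat K z).det ∂Measure.pi (fun _ : Fin n => ν)

/-- The integral over `z` of the determinant bordered by `x` and `y`. -/
def minorInt (H K : X → X → ℂ) (n : ℕ) (x y : X) : ℂ :=
  ∫ z, (borderMat H K x y z).det ∂Measure.pi (fun _ : Fin n => ν)

variable {ν} {w : X → ℝ} {C : ℝ} {H K : X → X → ℂ}

theorem detInt_zero : detInt ν K 0 = 1 := by
  simp [detInt, integral_unique, measureReal_def]

theorem minorInt_zero (x y : X) : minorInt ν H K 0 x y = H x y := by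
  simp only [minorInt, borderMat_zero]
  simp [measureReal_def]

theorem detInt_transpose (n : ℕ) : detInt ν (fun x y => K y x) n = detInt ν K n := by
  simp only [detInt, kerMat_transpose, Matrix.det_transpose]

theorem minorInt_transpose (n : ℕ) (x y : X) :
    minorInt ν (fun x y => K y x) (fun x y => K y x) n x y = minorInt ν K K n y x := by
  simp only [minorInt, borderMat_transpose, Matrix.det_transpose]

variable [SigmaFinite ν]

theorem integrable_prod_sq (hw : IsWeight ν w) (n : ℕ) :
    Integrable (fun z : Fin n → X => ∏ i, w (z i) ^ 2) (Measure.pi fun _ => ν) :=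
  Integrable.fintype_prod fun _ => hw.integrable

theorem integral_prod_sq (n : ℕ) :
    ∫ z, ∏ i, w (z i) ^ 2 ∂(Measure.pi fun _ : Fin n => ν) = (∫ x, w x ^ 2 ∂ν) ^ n := by
  rw [integral_fintype_prod_eq_pow (fun x => w x ^ 2), Fintype.card_fin]

theorem integrable_det_kerMat (hw : IsWeight ν w) (hK : Dominated w C K) (n : ℕ) :
    Integrable (fun z : Fin n → X => (kerMat K z).det) (Measure.pi fun _ => ν) :=
  ((integrable_prod_sq hw n).const_mul _).mono' (measurable_det_kerMat hK.measurable n).aestronglyMeasurable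
    (.of_forall fun z => norm_det_kerMat_le hw.pos hK z)

theorem norm_detInt_le (hw : IsWeight ν w) (hK : Dominated w C K) (n : ℕ) :
    ‖detInt ν K n‖ ≤ hadamardConst n * C ^ n * (∫ x, w x ^ 2 ∂ν) ^ n := by
  refine (norm_integral_le_of_norm_le ((integrable_prod_sq hw n).const_mul _)
    (.of_forall fun z => norm_det_kerMat_le hw.pos hK z)).trans_eq ?_
  rw [integral_const_mul, integral_prod_sq]

theorem norm_minorInt_le (hw : IsWeight ν w) (hH : Dominated w C H) (hK : Dominated w C K) (n : ℕ)
    (x y : X) : ‖minorInt ν H K n x y‖ ≤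
      hadamardConst (n + 1) * C ^ (n + 1) * (∫ x, w x ^ 2 ∂ν) ^ n * w x * w y := by
  refine (norm_integral_le_of_norm_le ((integrable_prod_sq hw n).const_mul _)
    (.of_forall fun z => norm_det_borderMat_le hw.pos hH hK x y z)).trans_eq ?_
  rw [integral_const_mul, integral_prod_sq]; ring

theorem measurable_minorInt (hH : Measurable fun p : X × X => H p.1 p.2)
    (hK : Measurable fun p : X × X => K p.1 p.2) (n : ℕ) :
    Measurable fun p : X × X => minorInt ν H K n p.1 p.2 :=
  (measurable_det_borderMat hH hK n).stronglyMeasurable.integral_prod_right.measurable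

/-- Integrating a function of one coordinate and of the others. -/
theorem integral_pi_succAbove {n : ℕ} (F : X → (Fin n → X) → ℂ) (j : Fin (n + 1))
    (hF : Integrable (fun p : X × (Fin n → X) => F p.1 p.2) (ν.prod (Measure.pi fun _ => ν))) :
    Integrable (fun z : Fin (n + 1) → X => F (z j) fun k => z (j.succAbove k))
      (Measure.pi fun _ => ν) ∧
    ∫ z, F (z j) (fun k => z (j.succAbove k)) ∂(Measure.pi fun _ : Fin (n + 1) => ν) =
      ∫ u, ∫ z, F u z ∂(Measure.pi fun _ : Fin n => ν) ∂ν := by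
  have hmp := measurePreserving_piFinSuccAbove (α := fun _ : Fin (n + 1) => X) (fun _ => ν) j
  constructor
  · exact (hmp.integrable_comp_emb (MeasurableEquiv.measurableEmbedding _)).2 hF
  · rw [← integral_prod _ hF]
    exact hmp.integral_comp (MeasurableEquiv.measurableEmbedding _)
      (fun p : X × (Fin n → X) => F p.1 p.2)

theorem integrable_prod_weight (hw : IsWeight ν w) (n : ℕ) (c : ℝ) {F : X × (Fin n → X) → ℂ}
    (hF : Measurable F) (hb : ∀ u z, ‖F (u, z)‖ ≤ c * w u ^ 2 * ∏ i, w (z i) ^ 2) :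
    Integrable F (ν.prod (Measure.pi fun _ => ν)) := by
  refine (((hw.integrable.mul_prod (integrable_prod_sq hw n))).const_mul c).mono'
    hF.aestronglyMeasurable (.of_forall fun p => (hb p.1 p.2).trans_eq ?_)
  ring

/-- The recursion of the Fredholm minors. -/
theorem minorInt_succ (hw : IsWeight ν w) (hH : Dominated w C H) (hK : Dominated w C K) (n : ℕ)
    (x y : X) : minorInt ν H K (n + 1) x y =
      H x y * detInt ν K (n + 1) - (n + 1) * ∫ u, H x u * minorInt ν K K n u y ∂ν := by
  have hint : Integrable (fun p : X × (Fin n → X) => H x p.1 * (borderMat K K p.1 y p.2).det)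
      (ν.prod (Measure.pi fun _ => ν)) := by
    refine integrable_prod_weight hw n
      (C * w x * (hadamardConst (n + 1) * C ^ (n + 1) * w y)) ?_ fun u z => ?_
    · have h1 : Measurable fun p : X × (Fin n → X) => H x p.1 :=
        hH.measurable.comp (measurable_const.prodMk measurable_fst)
      exact h1.mul ((measurable_det_borderMat hK.measurable hK.measurable n).comp
        ((measurable_fst.prodMk measurable_const).prodMk measurable_snd))
    · rw [norm_mul]
      have := hw.pos x; have := hw.pos u; have := hK.pos
      calc _ ≤ (C * w x * w u) * (hadamardConst (n + 1) * C ^ (n + 1) * w u * w y *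
            ∏ i, w (z i) ^ 2) := by
            gcongr
            · exact hH.bound x u
            · exact norm_det_borderMat_le hw.pos hK hK u y z
        _ = _ := by ring
  -- Splitting off the variable z j shows that the n + 1 terms of the expansion all have the same
  -- integral, which is the source of the factor n + 1.
  have hj := fun j : Fin (n + 1) => integral_pi_succAbove (ν := ν)
    (fun u (z : Fin n → X) => H x u * (borderMat K K u y z).det) j hint
  rw [minorInt]
  simp only [det_borderMat_succ]
  rw [integral_sub ((integrable_det_kerMat hw hK _).const_mul _)
    (integrable_finsetSum _ fun j _ => (hj j).1), integral_const_mul,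
    integral_finsetSum _ fun j _ => (hj j).1]
  simp only [(hj _).2, integral_const_mul, Finset.sum_const, Finset.card_univ, Fintype.card_fin,
    nsmul_eq_mul, detInt, minorInt, Nat.cast_add, Nat.cast_one]

end Integrals

end DerivedKernel

/-! ### The Fredholm series: integral equations of the minor and derivative of the determinant -/

namespace DerivedKernel

variable {X : Type*} [MeasurableSpace X]

section Definitions

variable (ν : Measure X)

/-- Composition of kernels. -/
def kcomp (K L : X → X → ℂ) (x y : X) : ℂ := ∫ u, K x u * L u y ∂ν

/-- The integral of a kernel over the diagonal. -/
def ktr (K : X → X → ℂ) : ℂ := ∫ u, K u u ∂ν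

/-- The Fredholm determinant of a kernel. -/
def fredDet (K : X → X → ℂ) : ℂ := ∑' n : ℕ, ((-1 : ℂ) ^ n / (n.factorial : ℂ)) * detInt ν K n

/-- The first Fredholm minor of a kernel `K`, with the kernel `H` in the first row. -/
def fredMinor (H K : X → X → ℂ) (x y : X) : ℂ :=
  ∑' n : ℕ, ((-1 : ℂ) ^ n / (n.factorial : ℂ)) * minorInt ν H K n x y

/-- The constant in the bound of the first Fredholm minor. -/
def minorConst (C W : ℝ) : ℝ :=
  ∑' n : ℕ, hadamardConst (n + 1) * C ^ (n + 1) * W ^ n / n.factorial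

end Definitions

variable {ν : Measure X} {w : X → ℝ} {C C' : ℝ} {H K L : X → X → ℂ}

theorem norm_neg_one_pow_div_factorial (n : ℕ) :
    ‖((-1 : ℂ) ^ n / (n.factorial : ℂ))‖ = 1 / n.factorial := by
  simp

theorem minorConst_nonneg (W : ℝ) (hC : 0 ≤ C) (hW : 0 ≤ W) : 0 ≤ minorConst C W :=
  tsum_nonneg fun n => by
    have := hadamardConst_nonneg (n + 1)
    positivity

theorem weight_integral_nonneg (ν : Measure X) (w : X → ℝ) : 0 ≤ ∫ x, w x ^ 2 ∂ν :=
  integral_nonneg fun _ => sq_nonneg _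

theorem Dominated.measurable_left (hK : Dominated w C K) (x : X) : Measurable fun u => K x u :=
  hK.measurable.comp measurable_prodMk_left

theorem Dominated.measurable_right (hK : Dominated w C K) (y : X) : Measurable fun u => K u y :=
  hK.measurable.comp measurable_prodMk_right

theorem Dominated.measurable_diag (hK : Dominated w C K) : Measurable fun u => K u u :=
  hK.measurable.comp (measurable_id.prodMk measurable_id)

theorem norm_mul_le_weight (hw : IsWeight ν w) (hK : Dominated w C K) (hL : Dominated w C' L)
    (x u y : X) : ‖K x u * L u y‖ ≤ C * C' * w x * w y * w u ^ 2 := by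
  rw [norm_mul]
  have := hw.pos x; have := hw.pos u; have := hK.pos
  calc ‖K x u‖ * ‖L u y‖ ≤ (C * w x * w u) * (C' * w u * w y) := by
        gcongr
        · exact hK.bound x u
        · exact hL.bound u y
    _ = _ := by ring

theorem integrable_kcomp (hw : IsWeight ν w) (hK : Dominated w C K) (hL : Dominated w C' L)
    (x y : X) : Integrable (fun u => K x u * L u y) ν :=
  (hw.integrable.const_mul _).mono'
    ((hK.measurable_left x).mul (hL.measurable_right y)).aestronglyMeasurable
    (.of_forall fun u => norm_mul_le_weight hw hK hL x u y)

theorem norm_kcomp_le (hw : IsWeight ν w) (hK : Dominated w C K) (hL : Dominated w C' L)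
    (x y : X) : ‖kcomp ν K L x y‖ ≤ C * C' * (∫ x, w x ^ 2 ∂ν) * w x * w y := by
  refine (norm_integral_le_of_norm_le (hw.integrable.const_mul _)
    (.of_forall fun u => norm_mul_le_weight hw hK hL x u y)).trans_eq ?_
  rw [integral_const_mul]; ring

theorem Dominated.kcomp [SFinite ν] (hw : IsWeight ν w) (hK : Dominated w C K)
    (hL : Dominated w C' L) : Dominated w (C * C' * (∫ x, w x ^ 2 ∂ν + 1)) (kcomp ν K L) where
  pos := by
    have := weight_integral_nonneg ν w; have := hK.pos; have := hL.pos
    positivity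
  measurable := by
    have h1 : Measurable fun p : (X × X) × X => K p.1.1 p.2 * L p.2 p.1.2 :=
      (hK.measurable.comp (f := fun p : (X × X) × X => (p.1.1, p.2)) (by fun_prop)).mul
        (hL.measurable.comp (f := fun p : (X × X) × X => (p.2, p.1.2)) (by fun_prop))
    exact h1.stronglyMeasurable.integral_prod_right.measurable
  bound x y := by
    have := hw.pos x; have := hw.pos y; have := hK.pos; have := hL.pos
    refine (norm_kcomp_le hw hK hL x y).trans ?_
    gcongr
    linarith

theorem integrable_diag (hw : IsWeight ν w) (hK : Dominated w C K) :
    Integrable (fun u => K u u) ν :=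
  (hw.integrable.const_mul C).mono' hK.measurable_diag.aestronglyMeasurable
    (.of_forall fun u => (hK.bound u u).trans_eq (by ring))

theorem fredDet_transpose : fredDet ν (fun x y => K y x) = fredDet ν K := by
  simp only [fredDet, detInt_transpose]

theorem fredMinor_transpose (x y : X) :
    fredMinor ν (fun x y => K y x) (fun x y => K y x) x y = fredMinor ν K K y x := by
  simp only [fredMinor, minorInt_transpose]

section Series

variable [SigmaFinite ν]

theorem norm_minor_term_le (hw : IsWeight ν w) (hH : Dominated w C H) (hK : Dominated w C K)
    (n : ℕ) (x y : X) : ‖((-1 : ℂ) ^ n / (n.factorial : ℂ)) * minorInt ν H K n x y‖ ≤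
      hadamardConst (n + 1) * C ^ (n + 1) * (∫ x, w x ^ 2 ∂ν) ^ n / n.factorial * (w x * w y) := by
  rw [norm_mul, norm_neg_one_pow_div_factorial]
  calc _ ≤ 1 / (n.factorial : ℝ) *
        (hadamardConst (n + 1) * C ^ (n + 1) * (∫ x, w x ^ 2 ∂ν) ^ n * w x * w y) := by
        gcongr; exact norm_minorInt_le hw hH hK n x y
    _ = _ := by ring

theorem summable_minor (hw : IsWeight ν w) (hH : Dominated w C H) (hK : Dominated w C K)
    (x y : X) :
    Summable fun n : ℕ => ((-1 : ℂ) ^ n / (n.factorial : ℂ)) * minorInt ν H K n x y :=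
  Summable.of_norm_bounded
    ((summable_hadamard C _ hK.pos.le (weight_integral_nonneg ν w)).mul_right _)
    fun n => norm_minor_term_le hw hH hK n x y

/-- The constant depends on the kernels only through C. This makes the bound uniform along a family
of kernels, which the differentiation of the resolvent requires. -/
theorem fredMinor_dominated (hw : IsWeight ν w) (hH : Dominated w C H) (hK : Dominated w C K) :
    Dominated w (minorConst C (∫ x, w x ^ 2 ∂ν) + 1) (fredMinor ν H K) where
  pos := by
    have := minorConst_nonneg _ hK.pos.le (weight_integral_nonneg ν w)
    linarith
  measurable := by
    refine measurable_of_tendsto_metrizable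
      (f := fun n (p : X × X) => ∑ k ∈ Finset.range n,
        ((-1 : ℂ) ^ k / (k.factorial : ℂ)) * minorInt ν H K k p.1 p.2)
      (fun n => Finset.measurable_sum _ fun k _ =>
        (measurable_minorInt hH.measurable hK.measurable k).const_mul _) ?_
    rw [tendsto_pi_nhds]
    exact fun p => (summable_minor hw hH hK p.1 p.2).hasSum.tendsto_sum_nat
  bound x y := by
    have hs := summable_hadamard C _ hK.pos.le (weight_integral_nonneg ν w)
    have := hw.pos x; have := hw.pos y
    calc ‖fredMinor ν H K x y‖ ≤ minorConst C (∫ x, w x ^ 2 ∂ν) * (w x * w y) := by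
          rw [minorConst, ← tsum_mul_right]
          exact tsum_of_norm_bounded (hs.mul_right _).hasSum
            fun n => norm_minor_term_le hw hH hK n x y
      _ ≤ (minorConst C (∫ x, w x ^ 2 ∂ν) + 1) * (w x * w y) := by gcongr; linarith
      _ = _ := by ring

theorem summable_det (hw : IsWeight ν w) (hK : Dominated w C K) :
    Summable fun n : ℕ => ((-1 : ℂ) ^ n / (n.factorial : ℂ)) * detInt ν K n := by
  rw [← summable_nat_add_iff 1]
  have hW := weight_integral_nonneg ν w
  refine Summable.of_norm_bounded ((summable_hadamard C _ hK.pos.le hW).mul_right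
    (∫ x, w x ^ 2 ∂ν)) fun n => ?_
  rw [norm_mul, norm_neg_one_pow_div_factorial]
  have hf : (n.factorial : ℝ) ≤ (n + 1).factorial := by
    exact_mod_cast Nat.factorial_le n.le_succ
  have hn : (0 : ℝ) < n.factorial := by exact_mod_cast n.factorial_pos
  have := norm_detInt_le hw hK (n + 1)
  have h0 := hadamardConst_nonneg (n + 1)
  have hC := hK.pos
  calc _ ≤ 1 / (n.factorial : ℝ) *
        (hadamardConst (n + 1) * C ^ (n + 1) * (∫ x, w x ^ 2 ∂ν) ^ (n + 1)) := by
        gcongr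
    _ = _ := by ring

/-- The integral equation of the first Fredholm minor. -/
theorem fredMinor_eq (hw : IsWeight ν w) (hH : Dominated w C H) (hK : Dominated w C K) (x y : X) :
    fredMinor ν H K x y = H x y * fredDet ν K + kcomp ν H (fredMinor ν K K) x y := by
  have hW := weight_integral_nonneg ν w
  have hsd := summable_det hw hK
  have hterm : ∀ n u, ‖H x u * (((-1 : ℂ) ^ n / (n.factorial : ℂ)) * minorInt ν K K n u y)‖ ≤
      hadamardConst (n + 1) * C ^ (n + 1) * (∫ x, w x ^ 2 ∂ν) ^ n / n.factorial *
        (C * w x * w y) * w u ^ 2 := by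
    intro n u
    rw [norm_mul]
    have := hw.pos x; have := hw.pos u; have := hK.pos
    calc _ ≤ (C * w x * w u) * (hadamardConst (n + 1) * C ^ (n + 1) * (∫ x, w x ^ 2 ∂ν) ^ n /
          n.factorial * (w u * w y)) := by
          gcongr
          · exact hH.bound x u
          · exact norm_minor_term_le hw hK hK n u y
      _ = _ := by ring
  have hint : ∀ n : ℕ, Integrable
      (fun u => H x u * (((-1 : ℂ) ^ n / (n.factorial : ℂ)) * minorInt ν K K n u y)) ν := by
    intro n
    refine (hw.integrable.const_mul _).mono' ?_ (.of_forall (hterm n))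
    exact ((hH.measurable_left x).mul (((measurable_minorInt hK.measurable hK.measurable n).comp
      measurable_prodMk_right).const_mul _)).aestronglyMeasurable
  have hsum : Summable fun n : ℕ =>
      ∫ u, ‖H x u * (((-1 : ℂ) ^ n / (n.factorial : ℂ)) * minorInt ν K K n u y)‖ ∂ν := by
    refine Summable.of_nonneg_of_le (fun n => integral_nonneg fun _ => norm_nonneg _) (fun n => ?_)
      (((summable_hadamard C _ hK.pos.le hW).mul_right (C * w x * w y)).mul_right
        (∫ x, w x ^ 2 ∂ν))
    rw [← integral_const_mul]
    exact integral_mono (hint n).norm (hw.integrable.const_mul _) (hterm n)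
  have hcomp : HasSum (fun n : ℕ => ((-1 : ℂ) ^ n / (n.factorial : ℂ)) *
      ∫ u, H x u * minorInt ν K K n u y ∂ν) (kcomp ν H (fredMinor ν K K) x y) := by
    have h := hasSum_integral_of_summable_integral_norm hint hsum
    simp only [tsum_mul_left] at h
    have he : (fun n : ℕ => ((-1 : ℂ) ^ n / (n.factorial : ℂ)) *
        ∫ u, H x u * minorInt ν K K n u y ∂ν) = fun n : ℕ =>
        ∫ u, H x u * (((-1 : ℂ) ^ n / (n.factorial : ℂ)) * minorInt ν K K n u y) ∂ν := by
      ext n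
      rw [← integral_const_mul]
      congr 1; ext u; ring
    rw [he]
    exact h
  -- The terms with n = 0 match directly; in the others the factor n + 1 of the recursion turns
  -- 1/(n+1)! into 1/n!, so the integral part is the minor series shifted by one.
  rw [fredMinor, (summable_minor hw hH hK x y).tsum_eq_zero_add, fredDet, hsd.tsum_eq_zero_add,
    ← hcomp.tsum_eq, detInt_zero, minorInt_zero]
  have h1 : ∀ n : ℕ, ((-1 : ℂ) ^ (n + 1) / ((n + 1).factorial : ℂ)) * minorInt ν H K (n + 1) x y =
      H x y * (((-1 : ℂ) ^ (n + 1) / ((n + 1).factorial : ℂ)) * detInt ν K (n + 1)) +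
      ((-1 : ℂ) ^ n / (n.factorial : ℂ)) * ∫ u, H x u * minorInt ν K K n u y ∂ν := by
    intro n
    rw [minorInt_succ hw hH hK, Nat.factorial_succ]
    have hn : (n.factorial : ℂ) ≠ 0 := by exact_mod_cast n.factorial_ne_zero
    have hn1 : ((n : ℂ) + 1) ≠ 0 := by exact_mod_cast n.succ_ne_zero
    push_cast
    field_simp
    ring
  simp only [h1]
  rw [Summable.tsum_add ((((summable_nat_add_iff 1).2 hsd)).mul_left _) hcomp.summable,
    tsum_mul_left]
  simp only [pow_zero, Nat.factorial_zero, Nat.cast_one, div_one, one_mul]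
  ring

/-- Transposing the kernel keeps the determinant and transposes the minor, so this is the first
equation for the transposed kernel. Both are needed for a two-sided inverse. -/
theorem fredMinor_eq' (hw : IsWeight ν w) (hK : Dominated w C K) (x y : X) :
    fredMinor ν K K x y = K x y * fredDet ν K + kcomp ν (fredMinor ν K K) K x y := by
  have h := fredMinor_eq hw hK.transpose hK.transpose y x
  rw [fredMinor_transpose, fredDet_transpose] at h
  rw [h, kcomp, kcomp]
  simp only [fredMinor_transpose, mul_comm]

section Derivative

variable {K K' : ℝ → X → X → ℂ} {T : Set ℝ}

theorem norm_det_borderMat_diag_le (hw : ∀ x, 0 < w x) {H K : X → X → ℂ} (hH : Dominated w C H)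
    (hK : Dominated w C K) {n : ℕ} (z : Fin (n + 1) → X) (i : Fin (n + 1)) :
    ‖(borderMat H K (z i) (z i) fun k => z (i.succAbove k)).det‖ ≤
      hadamardConst (n + 1) * C ^ (n + 1) * ∏ i, w (z i) ^ 2 := by
  refine (norm_det_borderMat_le hw hH hK _ _ _).trans_eq ?_
  rw [Fin.prod_univ_succAbove (fun j => w (z j) ^ 2) i]
  ring

theorem integrable_det_borderMat_diag (hw : IsWeight ν w) {H K : X → X → ℂ}
    (hH : Dominated w C H) (hK : Dominated w C K) (n : ℕ) :
    Integrable (fun p : X × (Fin n → X) => (borderMat H K p.1 p.1 p.2).det)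
      (ν.prod (Measure.pi fun _ => ν)) := by
  refine integrable_prod_weight hw n (hadamardConst (n + 1) * C ^ (n + 1)) ?_ fun u z => ?_
  · exact (measurable_det_borderMat hH.measurable hK.measurable n).comp
      ((measurable_fst.prodMk measurable_fst).prodMk measurable_snd)
  · exact (norm_det_borderMat_le hw.pos hH hK u u z).trans_eq (by ring)

/-- Each of the n + 1 rows contributes one determinant with that row replaced, and renaming the
integration variables makes their integrals equal. Hadamard's bound, uniform over T, dominates the
derivative. -/
theorem hasDerivAt_detInt (hw : IsWeight ν w) (hT : IsOpen T)
    (hK : ∀ t ∈ T, Dominated w C (K t)) (hK' : ∀ t ∈ T, Dominated w C (K' t))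
    (hd : ∀ t ∈ T, ∀ x y, HasDerivAt (fun t => K t x y) (K' t x y) t) (n : ℕ) {t : ℝ}
    (ht : t ∈ T) :
    HasDerivAt (fun t => detInt ν (K t) (n + 1))
      ((n + 1) * ∫ u, minorInt ν (K' t) (K t) n u u ∂ν) t := by
  have hi := fun i => integral_pi_succAbove (ν := ν)
    (fun u (z : Fin n → X) => (borderMat (K' t) (K t) u u z).det) i
    (integrable_det_borderMat_diag hw (hK' t ht) (hK t ht) n)
  have h := (hasDerivAt_integral_of_dominated_loc_of_deriv_le (μ := Measure.pi fun _ => ν)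
    (F := fun t (z : Fin (n + 1) → X) => (kerMat (K t) z).det)
    (F' := fun t z => ∑ i, (borderMat (K' t) (K t) (z i) (z i) fun k => z (i.succAbove k)).det)
    (bound := fun z => (n + 1) * (hadamardConst (n + 1) * C ^ (n + 1) * ∏ i, w (z i) ^ 2))
    (hT.mem_nhds ht)
    (Filter.eventually_of_mem (hT.mem_nhds ht) fun t ht =>
      (integrable_det_kerMat hw (hK t ht) (n + 1)).aestronglyMeasurable)
    (integrable_det_kerMat hw (hK t ht) (n + 1))
    (integrable_finsetSum _ fun i _ => (hi i).1).aestronglyMeasurable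
    (.of_forall fun z t ht => ?_)
    (((integrable_prod_sq hw (n + 1)).const_mul _).const_mul _)
    (.of_forall fun z t ht => hasDerivAt_det_kerMat K (K' t) t (hd t ht) z)).2
  · refine h.congr_deriv ?_
    rw [integral_finsetSum _ fun i _ => (hi i).1]
    simp only [(hi _).2, Finset.sum_const, Finset.card_univ, Fintype.card_fin, nsmul_eq_mul,
      minorInt, Nat.cast_add, Nat.cast_one]
  · refine (norm_sum_le_of_le _ fun i _ =>
      norm_det_borderMat_diag_le hw.pos (hK' t ht) (hK t ht) z i).trans_eq ?_
    simp

/-- The logarithmic derivative of the Fredholm determinant, in terms of the first minor. -/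
theorem hasDerivAt_fredDet (hw : IsWeight ν w) (hT : IsOpen T) (hTc : IsPreconnected T)
    (hK : ∀ t ∈ T, Dominated w C (K t)) (hK' : ∀ t ∈ T, Dominated w C (K' t))
    (hd : ∀ t ∈ T, ∀ x y, HasDerivAt (fun t => K t x y) (K' t x y) t) {t : ℝ} (ht : t ∈ T) :
    HasDerivAt (fun t => fredDet ν (K t)) (-ktr ν (fredMinor ν (K' t) (K t))) t := by
  have hC := (hK t ht).pos
  have hW := weight_integral_nonneg ν w
  have hsH := summable_hadamard C _ hC.le hW
  have hbd : ∀ t ∈ T, ∀ (n : ℕ) u,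
      ‖((-1 : ℂ) ^ n / (n.factorial : ℂ)) * minorInt ν (K' t) (K t) n u u‖ ≤
      hadamardConst (n + 1) * C ^ (n + 1) * (∫ x, w x ^ 2 ∂ν) ^ n / n.factorial * w u ^ 2 :=
    fun t ht n u => (norm_minor_term_le hw (hK' t ht) (hK t ht) n u u).trans_eq (by ring)
  have hint : ∀ t ∈ T, ∀ n : ℕ, Integrable
      (fun u => ((-1 : ℂ) ^ n / (n.factorial : ℂ)) * minorInt ν (K' t) (K t) n u u) ν := by
    intro t ht n
    refine (hw.integrable.const_mul _).mono' ?_ (.of_forall (hbd t ht n))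
    exact (((measurable_minorInt (hK' t ht).measurable (hK t ht).measurable n).comp
      (measurable_id.prodMk measurable_id)).const_mul _).aestronglyMeasurable
  have hterm : ∀ (n : ℕ), ∀ t ∈ T, HasDerivAt
      (fun t => ((-1 : ℂ) ^ (n + 1) / ((n + 1).factorial : ℂ)) * detInt ν (K t) (n + 1))
      (-∫ u, ((-1 : ℂ) ^ n / (n.factorial : ℂ)) * minorInt ν (K' t) (K t) n u u ∂ν) t := by
    intro n t ht
    refine ((hasDerivAt_detInt hw hT hK hK' hd n ht).const_mul _).congr_deriv ?_
    rw [integral_const_mul, Nat.factorial_succ]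
    have hn : (n.factorial : ℂ) ≠ 0 := by exact_mod_cast n.factorial_ne_zero
    have hn1 : ((n : ℂ) + 1) ≠ 0 := by exact_mod_cast n.succ_ne_zero
    push_cast
    field_simp
    ring
  -- Termwise differentiation: the derivatives of the terms are dominated, uniformly over T, by the
  -- summable Hadamard series.
  have hmain := hasDerivAt_tsum_of_isPreconnected (hsH.mul_right (∫ x, w x ^ 2 ∂ν)) hT hTc hterm
    (fun n t ht => by
      rw [norm_neg, ← integral_const_mul]
      exact norm_integral_le_of_norm_le (hw.integrable.const_mul _) (.of_forall (hbd t ht n)))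
    ht ((summable_nat_add_iff 1).2 (summable_det hw (hK t ht))) ht
  have hev : (fun t => fredDet ν (K t)) =ᶠ[nhds t] fun t =>
      1 + ∑' n : ℕ, ((-1 : ℂ) ^ (n + 1) / ((n + 1).factorial : ℂ)) * detInt ν (K t) (n + 1) := by
    filter_upwards [hT.mem_nhds ht] with t ht
    rw [fredDet, (summable_det hw (hK t ht)).tsum_eq_zero_add, detInt_zero]
    simp
  refine ((hmain.const_add 1).congr_of_eventuallyEq hev).congr_deriv ?_
  have hs : Summable fun n : ℕ =>
      ∫ u, ‖((-1 : ℂ) ^ n / (n.factorial : ℂ)) * minorInt ν (K' t) (K t) n u u‖ ∂ν := by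
    refine Summable.of_nonneg_of_le (fun n => integral_nonneg fun _ => norm_nonneg _) (fun n => ?_)
      (hsH.mul_right (∫ x, w x ^ 2 ∂ν))
    rw [← integral_const_mul]
    exact integral_mono (hint t ht n).norm (hw.integrable.const_mul _) (hbd t ht n)
  rw [tsum_neg, integral_tsum_of_summable_integral_norm (hint t ht) hs]
  rfl

end Derivative

end Series

end DerivedKernel

/-! ### Algebra and differential calculus of dominated kernels -/

namespace DerivedKernel

variable {X : Type*}

section

variable {w : X → ℝ} {a b : ℝ} {K L : X → X → ℂ}

/-- A pointwise bound by `a w(x) w(y)`. -/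
def KBound (w : X → ℝ) (a : ℝ) (K : X → X → ℂ) : Prop := ∀ x y, ‖K x y‖ ≤ a * w x * w y

theorem KBound.add (hK : KBound w a K) (hL : KBound w b L) : KBound w (a + b) (K + L) :=
  fun x y => (norm_add_le _ _).trans ((add_le_add (hK x y) (hL x y)).trans_eq (by ring))

theorem KBound.mono (hw : ∀ x, 0 < w x) (h : KBound w a K) (hab : a ≤ b) : KBound w b K :=
  fun x y => (h x y).trans (by have := hw x; have := hw y; gcongr)

end

variable [MeasurableSpace X]

/-- A measurable kernel dominated by a multiple of `w(x) w(y)`. -/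
def IsKer (w : X → ℝ) (K : X → X → ℂ) : Prop := ∃ C, Dominated w C K

variable {ν : Measure X} {w : X → ℝ} {C C' a b : ℝ} {H K K' L L' : X → X → ℂ}

theorem Dominated.isKer (h : Dominated w C K) : IsKer w K := ⟨C, h⟩

theorem Dominated.add (hK : Dominated w C K) (hL : Dominated w C' L) :
    Dominated w (C + C') (K + L) where
  pos := add_pos hK.pos hL.pos
  measurable := hK.measurable.add hL.measurable
  bound x y := (norm_add_le _ _).trans
    ((add_le_add (hK.bound x y) (hL.bound x y)).trans_eq (by ring))

theorem Dominated.neg (hK : Dominated w C K) : Dominated w C (-K) where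
  pos := hK.pos
  measurable := hK.measurable.neg
  bound x y := by simpa using hK.bound x y

theorem Dominated.sub (hK : Dominated w C K) (hL : Dominated w C' L) :
    Dominated w (C + C') (K - L) := by
  rw [sub_eq_add_neg]; exact hK.add hL.neg

theorem dominated_zero (hw : ∀ x, 0 < w x) (hC : 0 < C) : Dominated w C (0 : X → X → ℂ) where
  pos := hC
  measurable := measurable_const
  bound x y := by
    have := hw x; have := hw y
    simp only [Pi.zero_apply, norm_zero]; positivity

theorem IsKer.add (hK : IsKer w K) (hL : IsKer w L) : IsKer w (K + L) :=
  hK.elim fun _ h => hL.elim fun _ h' => (h.add h').isKer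

theorem IsKer.sub (hK : IsKer w K) (hL : IsKer w L) : IsKer w (K - L) :=
  hK.elim fun _ h => hL.elim fun _ h' => (h.sub h').isKer

theorem IsKer.kcomp [SFinite ν] (hw : IsWeight ν w) (hK : IsKer w K) (hL : IsKer w L) :
    IsKer w (kcomp ν K L) :=
  hK.elim fun _ h => hL.elim fun _ h' => (h.kcomp hw h').isKer

theorem IsKer.integrable_comp (hw : IsWeight ν w) (hK : IsKer w K) (hL : IsKer w L) (x y : X) :
    Integrable (fun u => K x u * L u y) ν :=
  hK.elim fun _ h => hL.elim fun _ h' => integrable_kcomp hw h h' x y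

theorem IsKer.integrable_diag (hw : IsWeight ν w) (hK : IsKer w K) :
    Integrable (fun u => K u u) ν :=
  hK.elim fun _ h => DerivedKernel.integrable_diag hw h

theorem ktr_add (hw : IsWeight ν w) (hK : IsKer w K) (hL : IsKer w L) :
    ktr ν (K + L) = ktr ν K + ktr ν L :=
  integral_add (hK.integrable_diag hw) (hL.integrable_diag hw)

theorem ktr_sub (hw : IsWeight ν w) (hK : IsKer w K) (hL : IsKer w L) :
    ktr ν (K - L) = ktr ν K - ktr ν L :=
  integral_sub (hK.integrable_diag hw) (hL.integrable_diag hw)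

theorem kcomp_sub_left (hw : IsWeight ν w) (hK : IsKer w K) (hK' : IsKer w K') (hL : IsKer w L) :
    kcomp ν (K - K') L = kcomp ν K L - kcomp ν K' L := by
  ext x y
  simp only [kcomp, Pi.sub_apply, sub_mul]
  exact integral_sub (hK.integrable_comp hw hL x y) (hK'.integrable_comp hw hL x y)

theorem kcomp_add_right (hw : IsWeight ν w) (hK : IsKer w K) (hL : IsKer w L) (hL' : IsKer w L') :
    kcomp ν K (L + L') = kcomp ν K L + kcomp ν K L' := by
  ext x y
  simp only [kcomp, Pi.add_apply, mul_add]
  exact integral_add (hK.integrable_comp hw hL x y) (hK.integrable_comp hw hL' x y)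

theorem kcomp_sub_right (hw : IsWeight ν w) (hK : IsKer w K) (hL : IsKer w L) (hL' : IsKer w L') :
    kcomp ν K (L - L') = kcomp ν K L - kcomp ν K L' := by
  ext x y
  simp only [kcomp, Pi.sub_apply, mul_sub]
  exact integral_sub (hK.integrable_comp hw hL x y) (hK.integrable_comp hw hL' x y)

theorem kcomp_zero_right : kcomp ν K 0 = 0 := by
  ext x y; simp [kcomp]

theorem kcomp_zero_left : kcomp ν 0 K = 0 := by
  ext x y; simp [kcomp]

theorem kcomp_assoc [SFinite ν] (hw : IsWeight ν w) (hH : IsKer w H) (hK : IsKer w K)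
    (hL : IsKer w L) : kcomp ν (kcomp ν H K) L = kcomp ν H (kcomp ν K L) := by
  obtain ⟨c, hH⟩ := hH
  obtain ⟨d, hK⟩ := hK
  obtain ⟨e, hL⟩ := hL
  ext x y
  simp only [kcomp, ← integral_mul_const, ← integral_const_mul]
  rw [integral_integral_swap]
  · simp only [mul_assoc]
  · refine ((hw.integrable.mul_prod hw.integrable).const_mul (c * d * e * w x * w y)).mono' ?_
      (.of_forall fun p => ?_)
    · have h1 := hH.measurable.comp (f := fun p : X × X => (x, p.2)) (by fun_prop)
      have h2 := hK.measurable.comp (f := fun p : X × X => (p.2, p.1)) (by fun_prop)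
      have h3 := hL.measurable.comp (f := fun p : X × X => (p.1, y)) (by fun_prop)
      exact ((h1.mul h2).mul h3).aestronglyMeasurable
    · obtain ⟨u, v⟩ := p
      simp only [Function.uncurry_apply_pair, norm_mul]
      have := hw.pos x; have := hw.pos u; have := hw.pos v; have := hH.pos; have := hK.pos
      calc ‖H x v‖ * ‖K v u‖ * ‖L u y‖ ≤
            (c * w x * w v) * (d * w v * w u) * (e * w u * w y) := by
            gcongr
            · exact hH.bound x v
            · exact hK.bound v u
            · exact hL.bound u y
        _ = _ := by ring

/-- The resolvent identity for kernels. -/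
theorem resolvent_identity [SFinite ν] (hw : IsWeight ν w) {K₁ R₁ K₂ R₂ : X → X → ℂ}
    (hK₁ : IsKer w K₁) (hR₁ : IsKer w R₁) (hK₂ : IsKer w K₂) (hR₂ : IsKer w R₂)
    (h₁ : R₁ = K₁ + kcomp ν K₁ R₁) (h₂ : R₂ = K₂ + kcomp ν R₂ K₂) :
    R₂ - R₁ = (K₂ - K₁ + kcomp ν (K₂ - K₁) R₁) +
      kcomp ν R₂ (K₂ - K₁ + kcomp ν (K₂ - K₁) R₁) := by
  -- As operators the claim reads R₂ - R₁ = (1 + R₂)(K₂ - K₁)(1 + R₁). Only K₁R₁ = R₁ - K₁ and R₂K₂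
  -- = R₂ - K₂ are used, and they reduce the triple products to double ones.
  have e1 : kcomp ν R₂ (kcomp ν K₁ R₁) = kcomp ν R₂ R₁ - kcomp ν R₂ K₁ := by
    rw [← kcomp_sub_right hw hR₂ hR₁ hK₁]; congr 1; exact eq_sub_of_add_eq' h₁.symm
  have e2 : kcomp ν R₂ (kcomp ν K₂ R₁) = kcomp ν R₂ R₁ - kcomp ν K₂ R₁ := by
    rw [← kcomp_sub_left hw hR₂ hK₂ hR₁, ← kcomp_assoc hw hR₂ hK₂ hR₁]; congr 1
    exact eq_sub_of_add_eq' h₂.symm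
  have hKR := fun {K} (hK : IsKer w K) => hK.kcomp hw hR₁
  rw [kcomp_sub_left hw hK₂ hK₁ hR₁, kcomp_add_right hw hR₂ (hK₂.sub hK₁) ((hKR hK₂).sub (hKR hK₁)),
    kcomp_sub_right hw hR₂ hK₂ hK₁, kcomp_sub_right hw hR₂ (hKR hK₂) (hKR hK₁), e1, e2]
  have e3 : kcomp ν R₂ K₂ = R₂ - K₂ := eq_sub_of_add_eq' h₂.symm
  have e4 : kcomp ν K₁ R₁ = R₁ - K₁ := eq_sub_of_add_eq' h₁.symm
  rw [e3, e4]
  abel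

theorem KBound.kcomp (hw : IsWeight ν w) (ha : 0 ≤ a) (hK : KBound w a K) (hL : KBound w b L) :
    KBound w (a * b * ∫ x, w x ^ 2 ∂ν) (kcomp ν K L) := by
  intro x y
  refine (norm_integral_le_of_norm_le (hw.integrable.const_mul (a * b * w x * w y))
    (.of_forall fun u => ?_)).trans_eq ?_
  · rw [norm_mul]
    have := hw.pos x; have := hw.pos u
    calc ‖K x u‖ * ‖L u y‖ ≤ (a * w x * w u) * (b * w u * w y) := by
          gcongr
          · exact hK x u
          · exact hL u y
      _ = _ := by ring
  · rw [integral_const_mul]; ring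

/-- Differentiation under the integral sign at a point, under a Lipschitz bound at this point. -/
theorem hasDerivAt_integral_of_lip_at {α : Type*} [MeasurableSpace α] {μ : Measure α}
    {F : ℝ → α → ℂ} {F' : α → ℂ} {t₀ : ℝ} {bound : α → ℝ}
    (hF : ∀ᶠ t in nhds t₀, Integrable (F t) μ)
    (hb : Integrable bound μ)
    (hlip : ∀ᶠ t in nhds t₀, ∀ a, ‖F t a - F t₀ a‖ ≤ bound a * |t - t₀|)
    (hd : ∀ a, HasDerivAt (fun t => F t a) (F' a) t₀) :
    HasDerivAt (fun t => ∫ a, F t a ∂μ) (∫ a, F' a ∂μ) t₀ := by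
  rw [hasDerivAt_iff_tendsto_slope]
  have h0 := hF.self_of_nhds
  have hlim : Filter.Tendsto (fun t => ∫ a, slope (fun t => F t a) t₀ t ∂μ) (nhdsWithin t₀ {t₀}ᶜ)
      (nhds (∫ a, F' a ∂μ)) := by
    refine tendsto_integral_filter_of_dominated_convergence bound ?_ ?_ hb
      (.of_forall fun a => hasDerivAt_iff_tendsto_slope.1 (hd a))
    · filter_upwards [hF.filter_mono nhdsWithin_le_nhds] with t ht
      simp only [slope_def_module]
      exact ((ht.sub h0).smul _).aestronglyMeasurable
    · filter_upwards [hlip.filter_mono nhdsWithin_le_nhds, self_mem_nhdsWithin] with t ht hne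
      refine .of_forall fun a => ?_
      have hpos : 0 < |t - t₀| := abs_pos.2 (sub_ne_zero.2 hne)
      rw [slope_def_module, norm_smul, norm_inv, Real.norm_eq_abs, inv_mul_le_iff₀ hpos, mul_comm]
      exact ht a
  refine hlim.congr' ?_
  filter_upwards [hF.filter_mono nhdsWithin_le_nhds] with t ht
  simp only [slope_def_module]
  rw [integral_smul, integral_sub ht h0]

/-- A family of kernels with derivative `K'` at `t₀`, in a form that permits to differentiate
integrals of these kernels. -/
structure KDeriv (w : X → ℝ) (C : ℝ) (t₀ : ℝ) (K : ℝ → X → X → ℂ) (K' : X → X → ℂ) : Prop where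
  dominated : ∀ᶠ t in nhds t₀, Dominated w C (K t)
  dominated' : Dominated w C K'
  lip : ∀ᶠ t in nhds t₀, KBound w (C * |t - t₀|) (K t - K t₀)
  deriv : ∀ x y, HasDerivAt (fun t => K t x y) (K' x y) t₀

namespace KDeriv

variable {t₀ : ℝ} {K L : ℝ → X → X → ℂ} {K' L' : X → X → ℂ}

theorem pos (h : KDeriv w C t₀ K K') : 0 < C := h.dominated'.pos

theorem congr (h : KDeriv w C t₀ K K') (hL : ∀ᶠ t in nhds t₀, L t = K t) :
    KDeriv w C t₀ L K' where
  dominated := by filter_upwards [h.dominated, hL] with t h1 h2; rwa [h2]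
  dominated' := h.dominated'
  lip := by filter_upwards [h.lip, hL] with t h1 h2; rwa [h2, hL.self_of_nhds]
  deriv x y := (h.deriv x y).congr_of_eventuallyEq (hL.mono fun t ht => by simp only [ht])

theorem const (hw : ∀ x, 0 < w x) {K : X → X → ℂ} (hK : Dominated w C K) :
    KDeriv w C t₀ (fun _ => K) 0 where
  dominated := .of_forall fun _ => hK
  dominated' := dominated_zero hw hK.pos
  lip := .of_forall fun t x y => by
    have := hw x; have := hw y; have := hK.pos
    simp only [sub_self, Pi.zero_apply, norm_zero]; positivity
  deriv x y := hasDerivAt_const _ _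

theorem add (hK : KDeriv w C t₀ K K') (hL : KDeriv w C' t₀ L L') :
    KDeriv w (C + C') t₀ (fun t => K t + L t) (K' + L') where
  dominated := by filter_upwards [hK.dominated, hL.dominated] with t h1 h2; exact h1.add h2
  dominated' := hK.dominated'.add hL.dominated'
  lip := by
    filter_upwards [hK.lip, hL.lip] with t h1 h2
    have : K t + L t - (K t₀ + L t₀) = (K t - K t₀) + (L t - L t₀) := by abel
    rw [this, add_mul]
    exact h1.add h2
  deriv x y := (hK.deriv x y).add (hL.deriv x y)

theorem sub_const {L : X → X → ℂ} (hK : KDeriv w C t₀ K K') (hL : Dominated w C' L) :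
    KDeriv w (C + C') t₀ (fun t => K t - L) K' where
  dominated := by filter_upwards [hK.dominated] with t h1; exact h1.sub hL
  dominated' := ⟨add_pos hK.pos hL.pos, hK.dominated'.measurable, fun x y => by
    obtain ⟨t, ht⟩ := hK.dominated.exists
    refine (hK.dominated'.bound x y).trans ?_
    have h1 := (norm_nonneg _).trans (hL.bound x y)
    linarith⟩
  lip := by
    filter_upwards [hK.lip] with t h1 x y
    have h2 := h1 x y
    have h3 := (norm_nonneg _).trans (hL.bound x y)
    have h4 : 0 ≤ |t - t₀| * (C' * w x * w y) := by positivity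
    simp only [Pi.sub_apply] at h2 ⊢
    rw [sub_sub_sub_cancel_right]
    linarith
  deriv x y := (hK.deriv x y).sub_const _

/-- The product rule, from K L - K₀L₀ = (K - K₀)L + K₀(L - L₀). The two summands account for the
factor 2 in the constant. -/
theorem kcomp [SFinite ν] (hw : IsWeight ν w) (hK : KDeriv w C t₀ K K')
    (hL : KDeriv w C' t₀ L L') :
    KDeriv w (2 * (C * C' * (∫ x, w x ^ 2 ∂ν + 1))) t₀ (fun t => kcomp ν (K t) (L t))
      (kcomp ν K' (L t₀) + kcomp ν (K t₀) L') := by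
  have hC := hK.pos
  have hC' := hL.pos
  have hW := weight_integral_nonneg ν w
  have hK0 := hK.dominated.self_of_nhds
  have hL0 := hL.dominated.self_of_nhds
  refine ⟨?_, ?_, ?_, fun x y => ?_⟩
  · filter_upwards [hK.dominated, hL.dominated] with t h1 h2
    exact (h1.kcomp hw h2).mono hw.pos (by
      have : 0 ≤ C * C' * (∫ x, w x ^ 2 ∂ν + 1) := by positivity
      linarith)
  · rw [two_mul]
    exact (hK.dominated'.kcomp hw hL0).add (hK0.kcomp hw hL.dominated')
  · filter_upwards [hK.dominated, hL.dominated, hK.lip, hL.lip] with t h1 h2 h3 h4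
    have e : DerivedKernel.kcomp ν (K t) (L t) - DerivedKernel.kcomp ν (K t₀) (L t₀) =
        DerivedKernel.kcomp ν (K t - K t₀) (L t) + DerivedKernel.kcomp ν (K t₀) (L t - L t₀) := by
      rw [kcomp_sub_left hw h1.isKer hK0.isKer h2.isKer,
        kcomp_sub_right hw hK0.isKer h2.isKer hL0.isKer]
      abel
    rw [e]
    refine ((KBound.kcomp hw (by positivity) h3 h2.bound).add
      (KBound.kcomp hw hC.le hK0.bound h4)).mono hw.pos ?_
    have : 0 ≤ C * C' * |t - t₀| := by positivity
    linarith
  · have hsum : (DerivedKernel.kcomp ν K' (L t₀) + DerivedKernel.kcomp ν (K t₀) L') x y =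
        ∫ u, (K' x u * L t₀ u y + K t₀ x u * L' u y) ∂ν := by
      rw [integral_add (integrable_kcomp hw hK.dominated' hL0 x y)
        (integrable_kcomp hw hK0 hL.dominated' x y)]
      rfl
    rw [hsum]
    refine hasDerivAt_integral_of_lip_at (bound := fun u => 2 * C * C' * w x * w y * w u ^ 2)
      ?_ (hw.integrable.const_mul _) ?_ fun u => (hK.deriv x u).mul (hL.deriv u y)
    · filter_upwards [hK.dominated, hL.dominated] with t h1 h2
      exact integrable_kcomp hw h1 h2 x y
    · filter_upwards [hL.dominated, hK.lip, hL.lip] with t h2 h3 h4 u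
      have e : K t x u * L t u y - K t₀ x u * L t₀ u y =
          (K t x u - K t₀ x u) * L t u y + K t₀ x u * (L t u y - L t₀ u y) := by ring
      rw [e]
      refine (norm_add_le _ _).trans ?_
      rw [norm_mul, norm_mul]
      have := hw.pos x; have := hw.pos u; have := hw.pos y
      calc _ ≤ (C * |t - t₀| * w x * w u) * (C' * w u * w y) +
            (C * w x * w u) * (C' * |t - t₀| * w u * w y) := by
            gcongr
            · exact h3 x u
            · exact h2.bound u y
            · exact hK0.bound x u
            · exact h4 u y
        _ = _ := by ring

theorem hasDerivAt_ktr (hw : IsWeight ν w) (hK : KDeriv w C t₀ K K') :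
    HasDerivAt (fun t => ktr ν (K t)) (ktr ν K') t₀ := by
  refine hasDerivAt_integral_of_lip_at (bound := fun u => C * w u ^ 2) ?_
    (hw.integrable.const_mul _) ?_ fun u => hK.deriv u u
  · filter_upwards [hK.dominated] with t h1
    exact integrable_diag hw h1
  · filter_upwards [hK.lip] with t h1 u
    exact (h1 u u).trans_eq (by ring)

/-- A family that vanishes to second order has derivative zero. -/
theorem of_sq (hw : ∀ x, 0 < w x) (hC : 0 < C) (hm : ∀ᶠ t in nhds t₀, Dominated w C (K t))
    (hb : ∀ᶠ t in nhds t₀, KBound w (C * |t - t₀| ^ 2) (K t)) : KDeriv w C t₀ K 0 := by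
  have h0 : K t₀ = 0 := by
    ext x y
    have := hb.self_of_nhds x y
    simpa using this
  have hlip : ∀ᶠ t in nhds t₀, KBound w (C * |t - t₀|) (K t - K t₀) := by
    have h1 : ∀ᶠ t in nhds t₀, |t - t₀| ≤ 1 := by
      filter_upwards [Metric.closedBall_mem_nhds t₀ one_pos] with t ht
      simpa [Real.dist_eq] using ht
    filter_upwards [hb, h1] with t h2 h3
    rw [h0, sub_zero]
    refine h2.mono hw ?_
    have := abs_nonneg (t - t₀)
    gcongr
    nlinarith
  refine ⟨hm, dominated_zero hw hC, hlip, fun x y => ?_⟩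
  rw [hasDerivAt_iff_isLittleO]
  simp only [h0, Pi.zero_apply, smul_zero, sub_zero]
  have hO : (fun t => K t x y) =O[nhds t₀] fun t => (t - t₀) ^ 2 := by
    refine Asymptotics.IsBigO.of_bound (C * w x * w y) ?_
    filter_upwards [hb] with t ht
    refine (ht x y).trans_eq ?_
    rw [norm_pow, Real.norm_eq_abs]; ring
  refine hO.trans_isLittleO ?_
  have : Filter.Tendsto (fun t => t - t₀) (nhds t₀) (nhds 0) := by
    have := (continuous_sub_right t₀).tendsto t₀
    simpa using this
  exact (Asymptotics.isLittleO_pow_id (𝕜 := ℝ) one_lt_two).comp_tendsto this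

/-- The derivative of the resolvent kernel. -/
theorem resolvent [SFinite ν] (hw : IsWeight ν w) {R : ℝ → X → X → ℂ} (hK : KDeriv w C t₀ K K')
    (hR : ∀ᶠ t in nhds t₀, Dominated w C' (R t))
    (h₁ : ∀ᶠ t in nhds t₀, R t = K t + DerivedKernel.kcomp ν (K t) (R t))
    (h₂ : ∀ᶠ t in nhds t₀, R t = K t + DerivedKernel.kcomp ν (R t) (K t)) :
    ∃ D, KDeriv w D t₀ R ((K' + DerivedKernel.kcomp ν K' (R t₀)) +
      DerivedKernel.kcomp ν (R t₀) (K' + DerivedKernel.kcomp ν K' (R t₀))) := by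
  have hK0 := hK.dominated.self_of_nhds
  have hR0 := hR.self_of_nhds
  have hW := weight_integral_nonneg ν w
  have hC := hK.pos
  have hC' := hR0.pos
  have hH := hK.sub_const hK0
  have hS := hH.add (hH.kcomp hw (const (t₀ := t₀) hw.pos hR0))
  rw [kcomp_zero_right, add_zero] at hS
  set S : ℝ → X → X → ℂ := fun t => K t - K t₀ + DerivedKernel.kcomp ν (K t - K t₀) (R t₀)
  obtain ⟨B, hB⟩ : ∃ B, KDeriv w B t₀ S (K' + DerivedKernel.kcomp ν K' (R t₀)) := ⟨_, hS⟩
  have hBpos := hB.pos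
  -- With S = (K - K₀)(1 + R₀), the resolvent identity is R - R₀ = (1 + R)S. As S is O(|t - t₀|) and
  -- R is uniformly dominated, R is Lipschitz at t₀, without any differentiability of R being
  -- assumed.
  have hid : ∀ᶠ t in nhds t₀, R t - R t₀ = S t + DerivedKernel.kcomp ν (R t) (S t) := by
    filter_upwards [hK.dominated, hR, h₂] with t a1 a2 a3
    exact resolvent_identity hw hK0.isKer hR0.isKer a1.isKer a2.isKer h₁.self_of_nhds a3
  have hS0 : S t₀ = 0 := by
    simp only [S, sub_self, kcomp_zero_left, add_zero]
  have hSb : ∀ᶠ t in nhds t₀, KBound w (B * |t - t₀|) (S t) := by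
    filter_upwards [hB.lip] with t ht
    rwa [hS0, sub_zero] at ht
  set M := B + C' * B * ∫ x, w x ^ 2 ∂ν
  have hM : 0 < M := by positivity
  have hRb : ∀ᶠ t in nhds t₀, KBound w (M * |t - t₀|) (R t - R t₀) := by
    filter_upwards [hid, hSb, hR] with t a1 a2 a3
    rw [a1]
    exact (a2.add (KBound.kcomp hw hC'.le a3.bound a2)).mono hw.pos (by
      simp only [M]; exact le_of_eq (by ring))
  -- In R S = R₀S + (R - R₀)S the last term is a product of two first-order quantities, so it does
  -- not contribute to the derivative.
  have hE : ∃ D, KDeriv w D t₀ (fun t => DerivedKernel.kcomp ν (R t - R t₀) (S t)) 0 := by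
    set D1 := M * B * ∫ x, w x ^ 2 ∂ν
    set D2 := (C' + C') * B * (∫ x, w x ^ 2 ∂ν + 1)
    have hD2 : 0 < D2 := by positivity
    have hD1 : 0 ≤ D1 := by positivity
    refine ⟨D1 + D2, of_sq hw.pos (by positivity) ?_ ?_⟩
    · filter_upwards [hR, hB.dominated] with t a1 a2
      exact ((a1.sub hR0).kcomp hw a2).mono hw.pos (by simp only [D2] at *; linarith)
    · filter_upwards [hRb, hSb] with t a1 a2
      refine (KBound.kcomp hw (by positivity) a1 a2).mono hw.pos ?_
      have : 0 ≤ D2 * |t - t₀| ^ 2 := by positivity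
      have e : M * |t - t₀| * (B * |t - t₀|) * ∫ x, w x ^ 2 ∂ν = D1 * |t - t₀| ^ 2 := by
        simp only [D1]; ring
      rw [e, add_mul]
      linarith
  obtain ⟨D, hE⟩ := hE
  have hRS := (const (t₀ := t₀) hw.pos hR0).kcomp hw hB
  rw [kcomp_zero_left, zero_add] at hRS
  have hfin := (const (t₀ := t₀) hw.pos hR0).add ((hB.add hRS).add hE)
  rw [add_zero, zero_add] at hfin
  refine ⟨_, hfin.congr ?_⟩
  filter_upwards [hid, hR, hB.dominated] with t a1 a2 a3
  rw [kcomp_sub_left hw a2.isKer hR0.isKer a3.isKer, ← sub_eq_iff_eq_add', a1]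
  abel

end KDeriv

end DerivedKernel

/-! ### Integral operators on L² and their traces -/

namespace DerivedKernel

variable {X : Type*} [MeasurableSpace X] {ν : Measure X} {w : X → ℝ} {C C' : ℝ}
  {K L P Q : X → X → ℂ}

theorem IsWeight.memLp (hw : IsWeight ν w) : MemLp w 2 ν :=
  (memLp_two_iff_integrable_sq hw.measurable.aestronglyMeasurable).2 hw.integrable

theorem Dominated.norm_le_norm (hw : ∀ x, 0 < w x) (hK : Dominated w C K) (x y : X) :
    ‖K x y‖ ≤ C * w x * ‖w y‖ := by
  rw [Real.norm_of_nonneg (hw y).le]; exact hK.bound x y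

theorem Dominated.memLp (hw : IsWeight ν w) (hK : Dominated w C K) (x : X) :
    MemLp (fun y => K x y) 2 ν :=
  hw.memLp.of_le_mul (hK.measurable_left x).aestronglyMeasurable
    (.of_forall fun y => hK.norm_le_norm hw.pos x y)

/-- The section `K(x, ·)` as an element of `L²`. -/
def rowL2 (hw : IsWeight ν w) (hK : Dominated w C K) (x : X) : Lp ℂ 2 ν := (hK.memLp hw x).toLp _

theorem norm_rowL2_le (hw : IsWeight ν w) (hK : Dominated w C K) (x : X) :
    ‖rowL2 hw hK x‖ ≤ C * w x * ‖hw.memLp.toLp w‖ := by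
  refine Lp.norm_le_mul_norm_of_ae_le_mul ?_
  filter_upwards [(hK.memLp hw x).coeFn_toLp, hw.memLp.coeFn_toLp] with y h1 h2
  rw [rowL2, h1, h2]
  exact hK.norm_le_norm hw.pos x y

theorem Dominated.conj (hK : Dominated w C K) :
    Dominated w C fun x y => (starRingEnd ℂ) (K x y) where
  pos := hK.pos
  measurable := Complex.continuous_conj.measurable.comp hK.measurable
  bound x y := by simpa using hK.bound x y

/-- Writing the integral as an inner product makes Cauchy–Schwarz and Parseval available; the
conjugate compensates the antilinearity in the first argument. -/
theorem inner_rowL2 (hw : IsWeight ν w) (hK : Dominated w C K) (x : X) (f : Lp ℂ 2 ν) :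
    inner ℂ (rowL2 hw hK.conj x) f = ∫ y, K x y * f y ∂ν := by
  rw [L2.inner_def]
  refine integral_congr_ae ?_
  filter_upwards [(hK.conj.memLp hw x).coeFn_toLp] with y h1
  rw [rowL2, h1, RCLike.inner_apply, Complex.conj_conj, mul_comm]

theorem inner_rowL2_right (hw : IsWeight ν w) (hK : Dominated w C K) (x : X) (f : Lp ℂ 2 ν) :
    inner ℂ f (rowL2 hw hK x) = ∫ y, K x y * (starRingEnd ℂ) (f y) ∂ν := by
  rw [L2.inner_def]
  refine integral_congr_ae ?_
  filter_upwards [(hK.memLp hw x).coeFn_toLp] with y h1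
  rw [rowL2, h1, RCLike.inner_apply]

theorem Dominated.integrable_mul (hw : IsWeight ν w) (hK : Dominated w C K) (x : X)
    (f : Lp ℂ 2 ν) : Integrable (fun y => K x y * f y) ν :=
  (hK.memLp hw x).integrable_mul (Lp.memLp f)

theorem norm_integral_mul_le (hw : IsWeight ν w) (hK : Dominated w C K) (x : X) (f : Lp ℂ 2 ν) :
    ‖∫ y, K x y * f y ∂ν‖ ≤ C * ‖hw.memLp.toLp w‖ * ‖f‖ * ‖w x‖ := by
  rw [← inner_rowL2 hw hK x f, Real.norm_of_nonneg (hw.pos x).le]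
  refine (norm_inner_le_norm _ _).trans ?_
  have := norm_rowL2_le hw hK.conj x
  calc _ ≤ C * w x * ‖hw.memLp.toLp w‖ * ‖f‖ := by gcongr
    _ = _ := by ring

/-- The bounded operator `T` on `L²(ν)` has the integral kernel `K`. -/
def IsKerOp (ν : Measure X) (K : X → X → ℂ) (T : Lp ℂ 2 ν →L[ℂ] Lp ℂ 2 ν) : Prop :=
  ∀ f : Lp ℂ 2 ν, T f =ᵐ[ν] fun x => ∫ y, K x y * f y ∂ν

theorem stronglyMeasurable_integral_mul [SFinite ν] (hK : Measurable fun p : X × X => K p.1 p.2)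
    {f : X → ℂ} (hf : StronglyMeasurable f) :
    StronglyMeasurable fun x => ∫ y, K x y * f y ∂ν := by
  have h1 : StronglyMeasurable fun p : X × X => K p.1 p.2 * f p.2 :=
    hK.stronglyMeasurable.mul (hf.comp_measurable measurable_snd)
  exact h1.integral_prod_right

theorem memLp_integral_mul [SFinite ν] (hw : IsWeight ν w) (hK : Dominated w C K) (f : Lp ℂ 2 ν) :
    MemLp (fun x => ∫ y, K x y * f y ∂ν) 2 ν :=
  hw.memLp.of_le_mul
    (stronglyMeasurable_integral_mul hK.measurable (Lp.stronglyMeasurable f)).aestronglyMeasurable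
    (.of_forall fun x => norm_integral_mul_le hw hK x f)

theorem exists_isKerOp [SFinite ν] (hw : IsWeight ν w) (hK : IsKer w K) :
    ∃ T, IsKerOp ν K T := by
  obtain ⟨C, hK⟩ := hK
  let T₀ : Lp ℂ 2 ν →ₗ[ℂ] Lp ℂ 2 ν :=
    { toFun := fun f => (memLp_integral_mul hw hK f).toLp _
      map_add' := fun f g => by
        rw [← MemLp.toLp_add]
        refine MemLp.toLp_congr _ _ (.of_forall fun x => ?_)
        simp only [Pi.add_apply, ← inner_rowL2 hw hK, inner_add_right]
      map_smul' := fun c f => by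
        rw [RingHom.id_apply, ← MemLp.toLp_const_smul]
        refine MemLp.toLp_congr _ _ (.of_forall fun x => ?_)
        simp only [Pi.smul_apply, ← inner_rowL2 hw hK, inner_smul_right, smul_eq_mul] }
  have hT₀ : ∀ f, T₀ f =ᵐ[ν] fun x => ∫ y, K x y * f y ∂ν :=
    fun f => (memLp_integral_mul hw hK f).coeFn_toLp
  refine ⟨T₀.mkContinuous (C * ‖hw.memLp.toLp w‖ * ‖hw.memLp.toLp w‖) fun f => ?_, hT₀⟩
  refine (Lp.norm_le_mul_norm_of_ae_le_mul (c := C * ‖hw.memLp.toLp w‖ * ‖f‖)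
    (g := hw.memLp.toLp w) ?_).trans_eq (by ring)
  filter_upwards [hT₀ f, hw.memLp.coeFn_toLp] with x h1 h2
  rw [h1, h2]
  exact norm_integral_mul_le hw hK x f

theorem IsKerOp.add (hw : IsWeight ν w) (hK : IsKer w K) (hL : IsKer w L)
    {T S : Lp ℂ 2 ν →L[ℂ] Lp ℂ 2 ν} (hT : IsKerOp ν K T) (hS : IsKerOp ν L S) :
    IsKerOp ν (K + L) (T + S) := by
  obtain ⟨C, hK⟩ := hK
  obtain ⟨D, hL⟩ := hL
  intro f
  rw [_root_.add_apply]
  filter_upwards [hT f, hS f, Lp.coeFn_add (T f) (S f)] with x h1 h2 h3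
  rw [h3, Pi.add_apply, h1, h2, ← integral_add (hK.integrable_mul hw x f) (hL.integrable_mul hw x f)]
  simp only [Pi.add_apply, add_mul]

theorem IsKerOp.sub (hw : IsWeight ν w) (hK : IsKer w K) (hL : IsKer w L)
    {T S : Lp ℂ 2 ν →L[ℂ] Lp ℂ 2 ν} (hT : IsKerOp ν K T) (hS : IsKerOp ν L S) :
    IsKerOp ν (K - L) (T - S) := by
  obtain ⟨C, hK⟩ := hK
  obtain ⟨D, hL⟩ := hL
  intro f
  rw [_root_.sub_apply]
  filter_upwards [hT f, hS f, Lp.coeFn_sub (T f) (S f)] with x h1 h2 h3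
  rw [h3, Pi.sub_apply, h1, h2, ← integral_sub (hK.integrable_mul hw x f) (hL.integrable_mul hw x f)]
  simp only [Pi.sub_apply, sub_mul]

theorem IsKerOp.unique {T S : Lp ℂ 2 ν →L[ℂ] Lp ℂ 2 ν} (hT : IsKerOp ν K T)
    (hS : IsKerOp ν K S) : T = S := by
  ext1 f
  exact Lp.ext ((hT f).trans (hS f).symm)

theorem integrable_prod_dominated [SFinite ν] (hw : IsWeight ν w) (hL : Dominated w C L)
    {g f : X → ℂ} (hg : MemLp g 2 ν) (hf : MemLp f 2 ν) :
    Integrable (fun p : X × X => g p.1 * L p.1 p.2 * f p.2) (ν.prod ν) := by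
  have h1 : Integrable (fun u => g u * w u) ν := hg.integrable_mul hw.memLp.ofReal
  have h2 : Integrable (fun u => f u * w u) ν := hf.integrable_mul hw.memLp.ofReal
  refine ((h1.mul_prod h2).norm.const_mul C).mono'
    ((hg.1.comp_fst.mul hL.measurable.aestronglyMeasurable).mul hf.1.comp_snd)
    (.of_forall fun p => ?_)
  have h3 := hL.bound p.1 p.2
  have hC := hL.pos
  simp only [norm_mul, Complex.norm_real, Real.norm_of_nonneg (hw.pos _).le]
  calc ‖g p.1‖ * ‖L p.1 p.2‖ * ‖f p.2‖ ≤ ‖g p.1‖ * (C * w p.1 * w p.2) * ‖f p.2‖ := by gcongr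
    _ = _ := by ring

theorem IsKerOp.mul [SFinite ν] (hw : IsWeight ν w) (hK : IsKer w K) (hL : IsKer w L)
    {T S : Lp ℂ 2 ν →L[ℂ] Lp ℂ 2 ν} (hT : IsKerOp ν K T) (hS : IsKerOp ν L S) :
    IsKerOp ν (kcomp ν K L) (T * S) := by
  obtain ⟨C, hK⟩ := hK
  obtain ⟨D, hL⟩ := hL
  intro f
  filter_upwards [hT (S f)] with x h1
  rw [mul_apply_eq_comp, h1]
  have h2 : ∫ u, K x u * S f u ∂ν = ∫ u, ∫ y, K x u * L u y * f y ∂ν ∂ν := by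
    refine integral_congr_ae ?_
    filter_upwards [hS f] with u hu
    rw [hu, ← integral_const_mul]
    simp only [mul_assoc]
  rw [h2, integral_integral_swap
    (integrable_prod_dominated hw hL (hK.memLp hw x) (Lp.memLp f))]
  simp only [integral_mul_const, kcomp]

/-- Cyclicity of the trace at the level of kernels is Fubini's theorem, with dominating function a
multiple of w(x)² w(y)². -/
theorem ktr_kcomp_comm [SFinite ν] (hw : IsWeight ν w) (hK : IsKer w K) (hL : IsKer w L) :
    ktr ν (kcomp ν K L) = ktr ν (kcomp ν L K) := by
  obtain ⟨C, hK⟩ := hK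
  obtain ⟨D, hL⟩ := hL
  simp only [ktr, kcomp]
  rw [integral_integral_swap]
  · simp only [mul_comm]
  · refine ((hw.integrable.mul_prod hw.integrable).const_mul (C * D)).mono'
      (hK.measurable.mul (hL.measurable.comp measurable_swap)).aestronglyMeasurable
      (.of_forall fun p => ?_)
    exact (norm_mul_le_weight hw hK hL p.1 p.2 p.1).trans_eq (by ring)

/-- Orthonormal vectors are at distance √2, so the balls of radius 1/2 around them are disjoint.
Countability of the index set is needed for dominated convergence along its finite subsets. -/
theorem Orthonormal.countable {H : Type*} [NormedAddCommGroup H] [InnerProductSpace ℂ H]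
    [TopologicalSpace.SeparableSpace H] {ι : Type*} {e : ι → H} (he : Orthonormal ℂ e) :
    Countable ι := by
  refine Pairwise.countable_of_isOpen_disjoint (s := fun i => Metric.ball (e i) (1 / 2))
    (fun i j hij => ?_) (fun _ => Metric.isOpen_ball)
    (fun i => ⟨e i, Metric.mem_ball_self (by norm_num)⟩)
  refine Metric.ball_disjoint_ball ?_
  have h1 : ‖e i - e j‖ ^ 2 = 2 := by
    rw [@norm_sub_sq ℂ, he.1 i, he.1 j, he.2 hij]; norm_num
  rw [dist_eq_norm]
  nlinarith [norm_nonneg (e i - e j)]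

/-- Cauchy–Schwarz followed by Bessel's inequality. The bound does not depend on the finite set, so
it serves as a dominating function for partial sums of traces. -/
theorem norm_sum_inner_mul_inner_le {H : Type*} [NormedAddCommGroup H] [InnerProductSpace ℂ H]
    {ι : Type*} {e : ι → H} (he : Orthonormal ℂ e) (s : Finset ι) (p q : H) :
    ‖∑ i ∈ s, inner ℂ p (e i) * inner ℂ (e i) q‖ ≤ ‖p‖ * ‖q‖ := by
  have h1 : ‖∑ i ∈ s, inner ℂ p (e i) * inner ℂ (e i) q‖ ≤
      ∑ i ∈ s, ‖inner ℂ (e i) p‖ * ‖inner ℂ (e i) q‖ := by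
    refine norm_sum_le_of_le _ fun i _ => ?_
    rw [norm_mul, norm_inner_symm]
  have h2 := Finset.sum_mul_sq_le_sq_mul_sq s (fun i => ‖inner ℂ (e i) p‖)
    (fun i => ‖inner ℂ (e i) q‖)
  have hp := he.sum_inner_products_le p (s := s)
  have hq := he.sum_inner_products_le q (s := s)
  refine h1.trans (abs_le_of_sq_le_sq' ?_ (by positivity)).2
  refine h2.trans ?_
  rw [mul_pow]
  gcongr

end DerivedKernel

namespace DerivedKernel

variable {X : Type} [MeasurableSpace X] {ν : Measure X} {w : X → ℝ} {C C' : ℝ}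
  {K L P Q : X → X → ℂ}

/-- The trace of a product of two operators with dominated kernels. -/
theorem IsKerOp.hasTrace_mul [SFinite ν] [TopologicalSpace.SeparableSpace (Lp ℂ 2 ν)]
    (hw : IsWeight ν w) (hP : IsKer w P) (hQ : IsKer w Q)
    {T S : Lp ℂ 2 ν →L[ℂ] Lp ℂ 2 ν} (hT : IsKerOp ν P T) (hS : IsKerOp ν Q S) :
    HasTrace (T * S) (ktr ν (kcomp ν P Q)) := by
  -- The diagonal integral is taken over the middle variable u of the product: for fixed u, Parseval
  -- sums ⟨conj Q(u,·), e i⟩⟨e i, P(·,u)⟩ to ∫ Q(u,y) P(y,u) dy.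
  rw [ktr_kcomp_comm hw hP hQ]
  obtain ⟨C, hP⟩ := hP
  obtain ⟨D, hQ⟩ := hQ
  intro ι e
  have : Countable ι := Orthonormal.countable e.orthonormal
  have hterm : ∀ i, inner ℂ (e i) ((T * S) (e i)) =
      ∫ u, inner ℂ (rowL2 hw hQ.conj u) (e i) * inner ℂ (e i) (rowL2 hw hP.transpose u) ∂ν := by
    intro i
    have h1 : inner ℂ (e i) ((T * S) (e i)) =
        ∫ x, ∫ u, (starRingEnd ℂ) (e i x) * P x u * S (e i) u ∂ν ∂ν := by
      rw [L2.inner_def]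
      refine integral_congr_ae ?_
      filter_upwards [hT (S (e i))] with x hx
      rw [mul_apply_eq_comp, hx, RCLike.inner_apply, ← integral_mul_const]
      congr 1; ext u; ring
    have hmem : MemLp (fun x => (starRingEnd ℂ) (e i x)) 2 ν := (Lp.memLp (e i)).star
    rw [h1, integral_integral_swap (integrable_prod_dominated hw hP hmem (Lp.memLp (S (e i))))]
    refine integral_congr_ae ?_
    filter_upwards [hS (e i)] with u hu
    rw [inner_rowL2 hw hQ, inner_rowL2_right hw hP.transpose, ← hu, integral_mul_const, mul_comm]
    simp only [mul_comm]
  have hlim : Filter.Tendsto (fun s : Finset ι => ∫ u, ∑ i ∈ s,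
      inner ℂ (rowL2 hw hQ.conj u) (e i) * inner ℂ (e i) (rowL2 hw hP.transpose u) ∂ν)
      Filter.atTop (nhds (ktr ν (kcomp ν Q P))) := by
    refine tendsto_integral_filter_of_dominated_convergence
      (fun u => D * ‖hw.memLp.toLp w‖ * (C * ‖hw.memLp.toLp w‖) * w u ^ 2) (.of_forall fun s => ?_)
      (.of_forall fun s => .of_forall fun u => ?_) (hw.integrable.const_mul _)
      (.of_forall fun u => ?_)
    · refine (Finset.stronglyMeasurable_fun_sum s fun i _ => ?_).aestronglyMeasurable
      simp only [inner_rowL2 hw hQ, inner_rowL2_right hw hP.transpose]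
      exact (stronglyMeasurable_integral_mul hQ.measurable (Lp.stronglyMeasurable _)).mul
        (stronglyMeasurable_integral_mul (K := fun x y => P y x) hP.transpose.measurable
          (Complex.continuous_conj.comp_stronglyMeasurable (Lp.stronglyMeasurable (e i))))
    · refine (norm_sum_inner_mul_inner_le e.orthonormal s _ _).trans ?_
      have h1 := norm_rowL2_le hw hQ.conj u
      have h2 := norm_rowL2_le hw hP.transpose u
      have hu := hw.pos u
      have := hQ.pos
      calc _ ≤ (D * w u * ‖hw.memLp.toLp w‖) * (C * w u * ‖hw.memLp.toLp w‖) := by gcongr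
        _ = _ := by ring
    · have h := e.hasSum_inner_mul_inner (rowL2 hw hQ.conj u) (rowL2 hw hP.transpose u)
      rw [inner_rowL2 hw hQ] at h
      have h3 : ∫ y, Q u y * rowL2 hw hP.transpose u y ∂ν = kcomp ν Q P u u := by
        refine integral_congr_ae ?_
        filter_upwards [(hP.transpose.memLp hw u).coeFn_toLp] with y hy
        rw [rowL2, hy]
      rw [h3] at h
      exact h
  refine hlim.congr fun s => ?_
  rw [integral_finsetSum]
  · simp only [hterm]
  · intro i _
    have h1 : MemLp (fun u => inner ℂ (rowL2 hw hQ.conj u) (e i)) 2 ν := by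
      simp only [inner_rowL2 hw hQ]; exact memLp_integral_mul hw hQ (e i)
    have h2 : MemLp (fun u => inner ℂ (e i) (rowL2 hw hP.transpose u)) 2 ν := by
      refine hw.memLp.of_le_mul (c := C * ‖hw.memLp.toLp w‖) ?_ (.of_forall fun u => ?_)
      · simp only [inner_rowL2_right hw hP.transpose]
        exact (stronglyMeasurable_integral_mul (K := fun x y => P y x) hP.transpose.measurable
          (Complex.continuous_conj.comp_stronglyMeasurable
            (Lp.stronglyMeasurable (e i)))).aestronglyMeasurable
      · refine (norm_inner_le_norm _ _).trans ?_
        rw [e.orthonormal.1 i, one_mul, Real.norm_of_nonneg (hw.pos u).le]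
        exact (norm_rowL2_le hw hP.transpose u).trans_eq (by ring)
    exact h1.integrable_mul h2

theorem HasTrace.add {H : Type} [NormedAddCommGroup H] [InnerProductSpace ℂ H]
    {T S : H →L[ℂ] H} {c d : ℂ} (hT : HasTrace T c) (hS : HasTrace S d) :
    HasTrace (T + S) (c + d) := fun ι e => by
  simpa only [_root_.add_apply, inner_add_right] using (hT ι e).add (hS ι e)

theorem HasTrace.sub {H : Type} [NormedAddCommGroup H] [InnerProductSpace ℂ H]
    {T S : H →L[ℂ] H} {c d : ℂ} (hT : HasTrace T c) (hS : HasTrace S d) :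
    HasTrace (T - S) (c - d) := fun ι e => by
  simpa only [_root_.sub_apply, inner_sub_right] using (hT ι e).sub (hS ι e)

end DerivedKernel

/-! ### Euler derivatives and dilations on the open quadrant -/

namespace DerivedKernel

/-- `F` is smooth on the open quadrant. -/
def SmoothQ (F : ℝ → ℝ → ℂ) : Prop :=
  ContDiffOn ℝ ∞ (fun p : ℝ × ℝ => F p.1 p.2) (Ioi 0 ×ˢ Ioi 0)

/-- `F` and `G` agree on the open quadrant. -/
def EqQ (F G : ℝ → ℝ → ℂ) : Prop := ∀ x y, 0 < x → 0 < y → F x y = G x y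

variable {F G H : ℝ → ℝ → ℂ} {x y : ℝ}

theorem isOpen_quadrant : IsOpen (Ioi (0 : ℝ) ×ˢ Ioi (0 : ℝ)) := isOpen_Ioi.prod isOpen_Ioi

theorem EqQ.refl (F : ℝ → ℝ → ℂ) : EqQ F F := fun _ _ _ _ => rfl

theorem EqQ.trans (h₁ : EqQ F G) (h₂ : EqQ G H) : EqQ F H :=
  fun x y hx hy => (h₁ x y hx hy).trans (h₂ x y hx hy)

theorem EqQ.add {F' G' : ℝ → ℝ → ℂ} (h₁ : EqQ F G) (h₂ : EqQ F' G') : EqQ (F + F') (G + G') :=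
  fun x y hx hy => congrArg₂ (· + ·) (h₁ x y hx hy) (h₂ x y hx hy)

theorem SmoothQ.congr (hF : SmoothQ F) (h : EqQ G F) : SmoothQ G :=
  ContDiffOn.congr hF fun p hp => h p.1 p.2 hp.1 hp.2

theorem SmoothQ.add (hF : SmoothQ F) (hG : SmoothQ G) : SmoothQ (F + G) := ContDiffOn.add hF hG

theorem SmoothQ.contDiffAt (hF : SmoothQ F) (hx : 0 < x) (hy : 0 < y) :
    ContDiffAt ℝ ∞ (fun p : ℝ × ℝ => F p.1 p.2) (x, y) :=
  ContDiffOn.contDiffAt hF (isOpen_quadrant.mem_nhds ⟨hx, hy⟩)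

theorem SmoothQ.hasFDerivAt (hF : SmoothQ F) (hx : 0 < x) (hy : 0 < y) :
    HasFDerivAt (fun p : ℝ × ℝ => F p.1 p.2) (fderiv ℝ (fun p : ℝ × ℝ => F p.1 p.2) (x, y))
      (x, y) :=
  ((hF.contDiffAt hx hy).differentiableAt (by simp)).hasFDerivAt

theorem SmoothQ.hasDerivAt_fst (hF : SmoothQ F) (hx : 0 < x) (hy : 0 < y) :
    HasDerivAt (fun t => F t y) (fderiv ℝ (fun p : ℝ × ℝ => F p.1 p.2) (x, y) (1, 0)) x :=
  (hF.hasFDerivAt hx hy).comp_hasDerivAt (f := fun t => (t, y)) x ((hasDerivAt_id x).prodMk (hasDerivAt_const x y))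

theorem SmoothQ.hasDerivAt_snd (hF : SmoothQ F) (hx : 0 < x) (hy : 0 < y) :
    HasDerivAt (fun t => F x t) (fderiv ℝ (fun p : ℝ × ℝ => F p.1 p.2) (x, y) (0, 1)) y :=
  (hF.hasFDerivAt hx hy).comp_hasDerivAt (f := fun t => (x, t)) y ((hasDerivAt_const y x).prodMk (hasDerivAt_id y))

theorem SmoothQ.eulerX_eq (hF : SmoothQ F) (hx : 0 < x) (hy : 0 < y) :
    eulerX F x y = x * fderiv ℝ (fun p : ℝ × ℝ => F p.1 p.2) (x, y) (1, 0) := by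
  rw [eulerX, (hF.hasDerivAt_fst hx hy).deriv]

theorem SmoothQ.eulerY_eq (hF : SmoothQ F) (hx : 0 < x) (hy : 0 < y) :
    eulerY F x y = y * fderiv ℝ (fun p : ℝ × ℝ => F p.1 p.2) (x, y) (0, 1) := by
  rw [eulerY, (hF.hasDerivAt_snd hx hy).deriv]

theorem SmoothQ.fderiv (hF : SmoothQ F) :
    ContDiffOn ℝ ∞ (fderiv ℝ (fun p : ℝ × ℝ => F p.1 p.2)) (Ioi 0 ×ˢ Ioi 0) :=
  ContDiffOn.fderiv_of_isOpen hF isOpen_quadrant (by simp)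

theorem contDiff_ofReal : ContDiff ℝ ∞ (fun t : ℝ => (t : ℂ)) := Complex.ofRealCLM.contDiff

theorem SmoothQ.eulerX (hF : SmoothQ F) : SmoothQ (eulerX F) := by
  have h : SmoothQ fun x y => x * _root_.fderiv ℝ (fun p : ℝ × ℝ => F p.1 p.2) (x, y) (1, 0) :=
    ((contDiff_ofReal.comp contDiff_fst).contDiffOn).mul (hF.fderiv.clm_apply contDiffOn_const)
  exact h.congr fun x y hx hy => hF.eulerX_eq hx hy

theorem SmoothQ.eulerY (hF : SmoothQ F) : SmoothQ (eulerY F) := by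
  have h : SmoothQ fun x y => y * _root_.fderiv ℝ (fun p : ℝ × ℝ => F p.1 p.2) (x, y) (0, 1) :=
    ((contDiff_ofReal.comp contDiff_snd).contDiffOn).mul (hF.fderiv.clm_apply contDiffOn_const)
  exact h.congr fun x y hx hy => hF.eulerY_eq hx hy

theorem derived_eq (F : ℝ → ℝ → ℂ) : derived F = F + eulerX F + eulerY F := rfl

theorem SmoothQ.derived (hF : SmoothQ F) : SmoothQ (derived F) :=
  (hF.add hF.eulerX).add hF.eulerY

theorem EqQ.eulerX (h : EqQ F G) : EqQ (eulerX F) (eulerX G) := by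
  intro x y hx hy
  have : (fun t => F t y) =ᶠ[nhds x] fun t => G t y := by
    filter_upwards [Ioi_mem_nhds hx] with t ht using h t y ht hy
  rw [DerivedKernel.eulerX, DerivedKernel.eulerX, this.deriv_eq]

theorem EqQ.eulerY (h : EqQ F G) : EqQ (eulerY F) (eulerY G) := by
  intro x y hx hy
  have : (fun t => F x t) =ᶠ[nhds y] fun t => G x t := by
    filter_upwards [Ioi_mem_nhds hy] with t ht using h x t hx ht
  rw [DerivedKernel.eulerY, DerivedKernel.eulerY, this.deriv_eq]

theorem eulerX_add (hF : SmoothQ F) (hG : SmoothQ G) :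
    EqQ (eulerX (F + G)) (eulerX F + eulerX G) := by
  intro x y hx hy
  have h := ((hF.hasDerivAt_fst hx hy).add (hG.hasDerivAt_fst hx hy)).deriv
  rw [Pi.add_apply, Pi.add_apply, hF.eulerX_eq hx hy, hG.eulerX_eq hx hy, ← mul_add, ← h]
  rfl

theorem eulerY_add (hF : SmoothQ F) (hG : SmoothQ G) :
    EqQ (eulerY (F + G)) (eulerY F + eulerY G) := by
  intro x y hx hy
  have h := ((hF.hasDerivAt_snd hx hy).add (hG.hasDerivAt_snd hx hy)).deriv
  rw [Pi.add_apply, Pi.add_apply, hF.eulerY_eq hx hy, hG.eulerY_eq hx hy, ← mul_add, ← h]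
  rfl

/-- The Euler derivatives commute. -/
theorem eulerY_eulerX (hF : SmoothQ F) : EqQ (eulerY (eulerX F)) (eulerX (eulerY F)) := by
  intro x y hx hy
  set f := fun p : ℝ × ℝ => F p.1 p.2
  have hd : HasFDerivAt (fderiv ℝ f) (fderiv ℝ (fderiv ℝ f) (x, y)) (x, y) :=
    ((hF.fderiv.contDiffAt (isOpen_quadrant.mem_nhds (x := (x, y)) ⟨hx, hy⟩)).differentiableAt
      (by simp)).hasFDerivAt
  have hsym : IsSymmSndFDerivAt ℝ f (x, y) :=
    (hF.contDiffAt hx hy).isSymmSndFDerivAt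
      (by rw [minSmoothness_of_isRCLikeNormedField]; exact WithTop.coe_le_coe.2 (le_top : (2 : ℕ∞) ≤ ⊤))
  have h1 : HasDerivAt (fun t => eulerX F x t)
      (x * (fderiv ℝ (fderiv ℝ f) (x, y) (0, 1)) (1, 0)) y := by
    have h2 : HasDerivAt (fun t => fderiv ℝ f (x, t))
        (fderiv ℝ (fderiv ℝ f) (x, y) (0, 1)) y :=
      hd.comp_hasDerivAt y ((hasDerivAt_const y x).prodMk (hasDerivAt_id y))
    have h3 := (h2.clm_apply (hasDerivAt_const y ((1 : ℝ), (0 : ℝ)))).const_mul (x : ℂ)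
    rw [map_zero, add_zero] at h3
    refine h3.congr_of_eventuallyEq ?_
    filter_upwards [Ioi_mem_nhds hy] with t ht using hF.eulerX_eq hx ht
  have h1' : HasDerivAt (fun t => eulerY F t y)
      (y * (fderiv ℝ (fderiv ℝ f) (x, y) (1, 0)) (0, 1)) x := by
    have h2 : HasDerivAt (fun t => fderiv ℝ f (t, y))
        (fderiv ℝ (fderiv ℝ f) (x, y) (1, 0)) x :=
      hd.comp_hasDerivAt x ((hasDerivAt_id x).prodMk (hasDerivAt_const x y))
    have h3 := (h2.clm_apply (hasDerivAt_const x ((0 : ℝ), (1 : ℝ)))).const_mul (y : ℂ)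
    rw [map_zero, add_zero] at h3
    refine h3.congr_of_eventuallyEq ?_
    filter_upwards [Ioi_mem_nhds hx] with t ht using hF.eulerY_eq ht hy
  rw [eulerY, h1.deriv, eulerX, h1'.deriv, hsym.eq (1, 0) (0, 1)]
  ring

section Iterate

variable {D E : (ℝ → ℝ → ℂ) → ℝ → ℝ → ℂ}

theorem SmoothQ.iterate (hD : ∀ {F}, SmoothQ F → SmoothQ (D F)) (hF : SmoothQ F) (n : ℕ) :
    SmoothQ (D^[n] F) := by
  induction n with
  | zero => exact hF
  | succ n ih => rw [Function.iterate_succ_apply']; exact hD ih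

theorem EqQ.iterate (hD : ∀ {F G}, EqQ F G → EqQ (D F) (D G)) (h : EqQ F G) (n : ℕ) :
    EqQ (D^[n] F) (D^[n] G) := by
  induction n with
  | zero => exact h
  | succ n ih => simp only [Function.iterate_succ_apply']; exact hD ih

theorem iterate_add (hS : ∀ {F}, SmoothQ F → SmoothQ (D F))
    (hD : ∀ {F G}, EqQ F G → EqQ (D F) (D G))
    (hA : ∀ {F G}, SmoothQ F → SmoothQ G → EqQ (D (F + G)) (D F + D G))
    (hF : SmoothQ F) (hG : SmoothQ G) (n : ℕ) : EqQ (D^[n] (F + G)) (D^[n] F + D^[n] G) := by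
  induction n with
  | zero => exact EqQ.refl _
  | succ n ih =>
    simp only [Function.iterate_succ_apply']
    exact (hD ih).trans (hA (hF.iterate hS n) (hG.iterate hS n))

theorem eulerY_iterate_eulerX (hF : SmoothQ F) (n : ℕ) :
    EqQ (eulerY^[n] (eulerX F)) (eulerX (eulerY^[n] F)) := by
  induction n with
  | zero => exact EqQ.refl _
  | succ n ih =>
    simp only [Function.iterate_succ_apply']
    exact ih.eulerY.trans (eulerY_eulerX (hF.iterate SmoothQ.eulerY n))

end Iterate

/-- Bounds for the Euler derivatives up to order `k` on `(0,S)²`. -/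
def EulerBound (S β : ℝ) (k : ℕ) (F : ℝ → ℝ → ℂ) : Prop :=
  ∀ i j : ℕ, i + j ≤ k → ∃ C : ℝ, ∀ x ∈ Ioo 0 S, ∀ y ∈ Ioo 0 S,
    ‖(eulerX^[i] (eulerY^[j] F)) x y‖ ≤ C * (x * y) ^ (-β)

/-- The derived kernel is (1 + x∂ₓ + y∂ᵧ)F. As the Euler derivatives commute on the quadrant, its
derivative of index (i,j) is the sum of those of F of index (i,j), (i+1,j) and (i,j+1). -/
theorem EulerBound.derived {S β : ℝ} {k : ℕ} (hF : SmoothQ F) (h : EulerBound S β (k + 1) F) :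
    EulerBound S β k (derived F) := by
  intro i j hij
  obtain ⟨A, hA⟩ := h i j (by omega)
  obtain ⟨B, hB⟩ := h (i + 1) j (by omega)
  obtain ⟨C, hC⟩ := h i (j + 1) (by omega)
  have hY := fun {F : ℝ → ℝ → ℂ} (hF : SmoothQ F) (n : ℕ) => hF.iterate SmoothQ.eulerY n
  have e1 : EqQ (eulerY^[j] (DerivedKernel.derived F))
      (eulerY^[j] F + eulerX (eulerY^[j] F) + eulerY^[j + 1] F) := by
    rw [derived_eq]
    refine (iterate_add SmoothQ.eulerY EqQ.eulerY eulerY_add (hF.add hF.eulerX) hF.eulerY j).trans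
      (EqQ.add ?_ (EqQ.refl _))
    exact (iterate_add SmoothQ.eulerY EqQ.eulerY eulerY_add hF hF.eulerX j).trans
      ((EqQ.refl _).add (eulerY_iterate_eulerX hF j))
  have e2 : EqQ (eulerX^[i] (eulerY^[j] (DerivedKernel.derived F)))
      (eulerX^[i] (eulerY^[j] F) + eulerX^[i + 1] (eulerY^[j] F) +
        eulerX^[i] (eulerY^[j + 1] F)) := by
    refine (e1.iterate EqQ.eulerX i).trans ?_
    refine (iterate_add SmoothQ.eulerX EqQ.eulerX eulerX_add
      ((hY hF j).add (hY hF j).eulerX) (hY hF (j + 1)) i).trans (EqQ.add ?_ (EqQ.refl _))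
    exact iterate_add SmoothQ.eulerX EqQ.eulerX eulerX_add (hY hF j) (hY hF j).eulerX i
  refine ⟨A + B + C, fun x hx y hy => ?_⟩
  rw [e2 x y hx.1 hy.1, add_mul, add_mul]
  exact (norm_add_le _ _).trans (add_le_add ((norm_add_le _ _).trans
    (add_le_add (hA x hx y hy) (hB x hx y hy))) (hC x hx y hy))

/-- The derivative of a kernel under dilations. -/
theorem SmoothQ.hasDerivAt_dilation (hF : SmoothQ F) {t : ℝ} (ht : 0 < t) (hx : 0 < x)
    (hy : 0 < y) :
    HasDerivAt (fun t : ℝ => (t : ℂ) * F (t * x) (t * y))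
      (DerivedKernel.derived F (t * x) (t * y)) t := by
  have htx := mul_pos ht hx
  have hty := mul_pos ht hy
  have h1 : HasDerivAt (fun t : ℝ => (t * x, t * y)) (x, y) t := by
    simpa using ((hasDerivAt_id t).mul_const x).prodMk ((hasDerivAt_id t).mul_const y)
  have h2 : HasDerivAt (fun t : ℝ => F (t * x) (t * y))
      (_root_.fderiv ℝ (fun p : ℝ × ℝ => F p.1 p.2) (t * x, t * y) (x, y)) t :=
    (hF.hasFDerivAt htx hty).comp_hasDerivAt (f := fun t : ℝ => (t * x, t * y)) t h1
  have h3 : HasDerivAt (fun t : ℝ => (t : ℂ)) 1 t := Complex.ofRealCLM.hasDerivAt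
  refine (h3.mul h2).congr_deriv ?_
  have e : ((x, y) : ℝ × ℝ) = x • ((1 : ℝ), (0 : ℝ)) + y • ((0 : ℝ), (1 : ℝ)) := by simp
  rw [e, map_add, map_smul, map_smul, DerivedKernel.derived, hF.eulerX_eq htx hty,
    hF.eulerY_eq htx hty]
  simp only [Complex.real_smul, one_mul]
  push_cast
  ring

/-- Recovering a kernel from its Euler derivative. -/
theorem SmoothQ.integral_eulerX (hF : SmoothQ F) {s : ℝ} (hx : 0 < x) (hxs : x ≤ s) (hy : 0 < y) :
    F x y = F s y - ∫ t in x..s, ((t⁻¹ : ℝ) : ℂ) * DerivedKernel.eulerX F t y := by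
  have hpos : ∀ t ∈ uIcc x s, 0 < t := fun t ht => by
    rw [uIcc_of_le hxs] at ht; exact hx.trans_le ht.1
  have hd : ∀ t ∈ uIcc x s, HasDerivAt (fun t => F t y)
      (((t⁻¹ : ℝ) : ℂ) * DerivedKernel.eulerX F t y) t := by
    intro t ht
    have h0 := hpos t ht
    refine (hF.hasDerivAt_fst h0 hy).congr_deriv ?_
    have : (t : ℂ) ≠ 0 := by exact_mod_cast h0.ne'
    rw [hF.eulerX_eq h0 hy]
    push_cast
    field_simp
  have hc : ContinuousOn (fun t : ℝ => ((t⁻¹ : ℝ) : ℂ) * DerivedKernel.eulerX F t y)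
      (uIcc x s) := by
    refine ContinuousOn.mul ?_ ?_
    · exact Complex.continuous_ofReal.comp_continuousOn
        (continuousOn_id.inv₀ fun t ht => (hpos t ht).ne')
    · exact (ContDiffOn.continuousOn hF.eulerX).comp (f := fun t : ℝ => (t, y)) (by fun_prop)
        fun t ht => ⟨hpos t ht, hy⟩
  rw [intervalIntegral.integral_eq_sub_of_hasDerivAt hd hc.intervalIntegrable]
  ring

end DerivedKernel

/-! ### Kernels on (0,s): power weights, dilated families, trace class -/

namespace DerivedKernel

/-- The kernel `F` on `(0,s)²`, extended by zero. -/
def cutK (s : ℝ) (F : ℝ → ℝ → ℂ) (x y : ℝ) : ℂ := if x ∈ Ioo 0 s ∧ y ∈ Ioo 0 s then F x y else 0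

/-- The weight `x^{-γ}` on `(0,s)`. -/
def powWeight (s γ x : ℝ) : ℝ := if x ∈ Ioo 0 s then x ^ (-γ) else 1

/-- The kernel `F` transported from `(0,ts)` to `(0,s)`. -/
def dilate (F : ℝ → ℝ → ℂ) (t x y : ℝ) : ℂ := (t : ℂ) * F (t * x) (t * y)

variable {s β γ C : ℝ} {F : ℝ → ℝ → ℂ} {x y : ℝ}

theorem cutK_of_mem (hx : x ∈ Ioo 0 s) (hy : y ∈ Ioo 0 s) : cutK s F x y = F x y :=
  if_pos ⟨hx, hy⟩

theorem cutK_of_notMem (h : ¬(x ∈ Ioo 0 s ∧ y ∈ Ioo 0 s)) : cutK s F x y = 0 := if_neg h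

theorem powWeight_of_mem (hx : x ∈ Ioo 0 s) : powWeight s γ x = x ^ (-γ) := if_pos hx

theorem powWeight_pos (x : ℝ) : 0 < powWeight s γ x := by
  rw [powWeight]
  split_ifs with h
  · exact Real.rpow_pos_of_pos h.1 _
  · exact one_pos

/-- The condition γ < 1/2 is what makes x^(-2γ) integrable at 0. The value 1 off the interval only
serves to keep the weight positive everywhere. -/
theorem isWeight_powWeight (hs : 0 < s) (hγ : γ < 1 / 2) :
    IsWeight (volume.restrict (Ioo 0 s)) (powWeight s γ) where
  measurable := Measurable.ite measurableSet_Ioo (by fun_prop) measurable_const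
  pos := powWeight_pos
  integrable := by
    have h : IntegrableOn (fun x : ℝ => x ^ (-2 * γ)) (Ioo 0 s) :=
      (intervalIntegral.integrableOn_Ioo_rpow_iff hs).2 (by linarith)
    refine IntegrableOn.congr_fun h (fun x hx => ?_) measurableSet_Ioo
    rw [powWeight_of_mem hx, ← Real.rpow_natCast, ← Real.rpow_mul hx.1.le]
    congr 1; push_cast; ring

theorem dominated_cutK (hm : Measurable fun p : ℝ × ℝ => cutK s F p.1 p.2) (hC : 0 < C)
    (hb : ∀ x ∈ Ioo 0 s, ∀ y ∈ Ioo 0 s, ‖F x y‖ ≤ C * x ^ (-γ) * y ^ (-γ)) :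
    Dominated (powWeight s γ) C (cutK s F) where
  pos := hC
  measurable := hm
  bound x y := by
    by_cases h : x ∈ Ioo 0 s ∧ y ∈ Ioo 0 s
    · rw [cutK_of_mem h.1 h.2, powWeight_of_mem h.1, powWeight_of_mem h.2]
      exact hb x h.1 y h.2
    · rw [cutK_of_notMem h, norm_zero]
      have := powWeight_pos (s := s) (γ := γ) x
      have := powWeight_pos (s := s) (γ := γ) y
      positivity

theorem measurable_cutK_of_continuousOn
    (hF : ContinuousOn (fun p : ℝ × ℝ => F p.1 p.2) (Ioo 0 s ×ˢ Ioo 0 s)) :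
    Measurable fun p : ℝ × ℝ => cutK s F p.1 p.2 := by
  classical
  have h := hF.measurable_piecewise (g := fun _ => 0) continuousOn_const
    (measurableSet_Ioo.prod measurableSet_Ioo)
  convert h using 2 with p
  simp only [cutK, piecewise, mem_prod]

theorem measurable_cutK (hF : Measurable fun p : ℝ × ℝ => F p.1 p.2) :
    Measurable fun p : ℝ × ℝ => cutK s F p.1 p.2 :=
  Measurable.ite ((measurableSet_Ioo.preimage measurable_fst).inter
    (measurableSet_Ioo.preimage measurable_snd)) hF measurable_const

theorem rpow_neg_le_mul_rpow_neg {a b : ℝ} (ha : 0 < a) (hab : a ≤ b) (hβγ : β ≤ γ) :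
    a ^ (-β) ≤ b ^ (γ - β) * a ^ (-γ) := by
  have h1 : a ^ (-β) = a ^ (γ - β) * a ^ (-γ) := by
    rw [← Real.rpow_add ha]; congr 1; ring
  rw [h1]
  have := Real.rpow_le_rpow ha.le hab (sub_nonneg.2 hβγ)
  have := Real.rpow_nonneg ha.le (-γ)
  gcongr

/-- On a bounded square, raising the exponent costs only a constant. This allows the exponent to be
taken nonnegative, and leaves room between it and 1/2. -/
theorem EulerBound.mono_exponent {S : ℝ} {k : ℕ} (h : EulerBound S β k F) (hβγ : β ≤ γ) :
    EulerBound S γ k F := by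
  intro i j hij
  obtain ⟨C, hC⟩ := h i j hij
  refine ⟨|C| * (S * S) ^ (γ - β), fun x hx y hy => ?_⟩
  have hxy : 0 < x * y := mul_pos hx.1 hy.1
  have hle : x * y ≤ S * S := mul_le_mul hx.2.le hy.2.le hy.1.le (hx.1.trans hx.2).le
  calc _ ≤ C * (x * y) ^ (-β) := hC x hx y hy
    _ ≤ |C| * ((S * S) ^ (γ - β) * (x * y) ^ (-γ)) := by
        have := rpow_neg_le_mul_rpow_neg hxy hle hβγ
        have := Real.rpow_nonneg hxy.le (-β)
        gcongr
        exact le_abs_self C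
    _ = _ := by ring

/-- The bound of a kernel, with a positive constant. -/
theorem EulerBound.exists_bound {S : ℝ} {k : ℕ} (h : EulerBound S β k F) (i : ℕ) (hi : i ≤ k) :
    ∃ C, 0 < C ∧ ∀ x ∈ Ioo 0 S, ∀ y ∈ Ioo 0 S, ‖(eulerX^[i] F) x y‖ ≤ C * x ^ (-β) * y ^ (-β) := by
  obtain ⟨C, hC⟩ := h i 0 (by omega)
  refine ⟨|C| + 1, by positivity, fun x hx y hy => (hC x hx y hy).trans ?_⟩
  rw [mul_assoc, ← Real.mul_rpow hx.1.le hy.1.le]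
  have := Real.rpow_nonneg (mul_pos hx.1 hy.1).le (-β)
  have := le_abs_self C
  gcongr
  linarith

/-- For 1/2 < t < 2 the point tx stays in (0,2s), hence the bounds on the doubled square, and
(tx)^(-γ) ≤ 2^γ x^(-γ) because γ ≥ 0. A single constant works for all these t. -/
theorem dominated_dilation (hγ : 0 ≤ γ) (hF : SmoothQ F)
    (h : EulerBound (2 * s) γ 0 F) : ∃ C, ∀ t ∈ Ioo (1 / 2 : ℝ) 2,
      Dominated (powWeight s γ) C (cutK s fun x y => F (t * x) (t * y)) ∧
      Dominated (powWeight s γ) C (cutK s (dilate F t)) := by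
  obtain ⟨C, hC, hb⟩ := h.exists_bound 0 le_rfl
  set D := C * 2 ^ γ * 2 ^ γ
  have hD : 0 < D := by positivity
  have hmem : ∀ t ∈ Ioo (1 / 2 : ℝ) 2, ∀ x ∈ Ioo 0 s, t * x ∈ Ioo 0 (2 * s) := fun t ht x hx =>
    ⟨mul_pos (by linarith [ht.1]) hx.1, mul_lt_mul'' ht.2 hx.2 (by linarith [ht.1]) hx.1.le⟩
  have hpow : ∀ t ∈ Ioo (1 / 2 : ℝ) 2, ∀ x ∈ Ioo 0 s, (t * x) ^ (-γ) ≤ 2 ^ γ * x ^ (-γ) := by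
    intro t ht x hx
    have ht0 : 0 < t := by linarith [ht.1]
    rw [Real.mul_rpow ht0.le hx.1.le]
    have h1 : t ^ (-γ) ≤ 2 ^ γ := by
      rw [Real.rpow_neg ht0.le, ← Real.inv_rpow ht0.le]
      refine Real.rpow_le_rpow (by positivity) ?_ hγ
      rw [inv_le_comm₀ ht0 two_pos]
      linarith [ht.1]
    have := Real.rpow_nonneg hx.1.le (-γ)
    gcongr
  have hb' : ∀ t ∈ Ioo (1 / 2 : ℝ) 2, ∀ x ∈ Ioo 0 s, ∀ y ∈ Ioo 0 s,
      ‖F (t * x) (t * y)‖ ≤ D * x ^ (-γ) * y ^ (-γ) := by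
    intro t ht x hx y hy
    refine (hb _ (hmem t ht x hx) _ (hmem t ht y hy)).trans ?_
    have h1 := Real.rpow_nonneg (hmem t ht y hy).1.le (-γ)
    have h2 := Real.rpow_nonneg hx.1.le (-γ)
    calc _ ≤ C * (2 ^ γ * x ^ (-γ)) * (2 ^ γ * y ^ (-γ)) := by
          gcongr
          · exact hpow t ht x hx
          · exact hpow t ht y hy
      _ = _ := by simp only [D]; ring
  have hcont : ∀ t ∈ Ioo (1 / 2 : ℝ) 2,
      ContinuousOn (fun p : ℝ × ℝ => F (t * p.1) (t * p.2)) (Ioo 0 s ×ˢ Ioo 0 s) := by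
    intro t ht
    refine (ContDiffOn.continuousOn hF).comp (f := fun p : ℝ × ℝ => (t * p.1, t * p.2))
      (by fun_prop) fun p hp => ?_
    exact ⟨(hmem t ht _ hp.1).1, (hmem t ht _ hp.2).1⟩
  refine ⟨2 * D, fun t ht => ⟨?_, ?_⟩⟩
  · exact (dominated_cutK (measurable_cutK_of_continuousOn (hcont t ht)) hD (hb' t ht)).mono
      powWeight_pos (by linarith)
  · refine dominated_cutK (measurable_cutK_of_continuousOn
      (continuousOn_const.mul (hcont t ht))) (by positivity) fun x hx y hy => ?_
    have ht0 : 0 < t := by linarith [ht.1]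
    rw [dilate, norm_mul, Complex.norm_real, Real.norm_of_nonneg ht0.le, mul_assoc 2 D,
      mul_assoc 2]
    have := hb' t ht x hx y hy
    gcongr
    exact ht.2.le

theorem hasDerivAt_cutK_dilate (hF : SmoothQ F) {t : ℝ} (ht : 0 < t) (x y : ℝ) :
    HasDerivAt (fun t => cutK s (dilate F t) x y)
      (cutK s (fun x y => derived F (t * x) (t * y)) x y) t := by
  by_cases h : x ∈ Ioo 0 s ∧ y ∈ Ioo 0 s
  · simp only [cutK_of_mem h.1 h.2]
    exact hF.hasDerivAt_dilation ht h.1.1 h.2.1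
  · simp only [cutK_of_notMem h]
    exact hasDerivAt_const _ _

theorem dilate_one : dilate F 1 = F := by
  ext x y; simp [dilate]

/-- The mean value inequality supplies the Lipschitz bound: the t-derivative is the derived kernel
at dilated points, which is uniformly dominated. -/
theorem kderiv_dilate (hγ : 0 ≤ γ) (hF : SmoothQ F) (h : EulerBound (2 * s) γ 1 F) :
    ∃ C, KDeriv (powWeight s γ) C 1 (fun t => cutK s (dilate F t)) (cutK s (derived F)) := by
  have hmem : Ioo (1 / 2 : ℝ) 2 ∈ nhds (1 : ℝ) := Ioo_mem_nhds (by norm_num) (by norm_num)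
  obtain ⟨A, hA⟩ := dominated_dilation hγ hF fun i j hij => h i j (by omega)
  obtain ⟨B, hB⟩ := dominated_dilation hγ hF.derived (h.derived hF)
  have h1 : (1 : ℝ) ∈ Ioo (1 / 2 : ℝ) 2 := mem_of_mem_nhds hmem
  have hA0 := (hA 1 h1).1.pos
  have hB0 := (hB 1 h1).1.pos
  have hle : B ≤ A + B := by linarith
  refine ⟨A + B, Filter.eventually_of_mem hmem fun t ht =>
    (hA t ht).2.mono powWeight_pos (by linarith), ?_, ?_, fun x y => ?_⟩
  · have := (hB 1 h1).1
    simp only [one_mul] at this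
    exact this.mono powWeight_pos hle
  · refine Filter.eventually_of_mem hmem fun t ht x y => ?_
    have := (convex_Ioo (1 / 2 : ℝ) 2).norm_image_sub_le_of_norm_hasDerivWithin_le
      (C := B * powWeight s γ x * powWeight s γ y)
      (fun t ht => (hasDerivAt_cutK_dilate (s := s) hF (t := t)
        (by linarith [ht.1]) x y).hasDerivWithinAt)
      (fun t ht => (hB t ht).1.bound x y) h1 ht
    rw [Real.norm_eq_abs] at this
    have hx := powWeight_pos (s := s) (γ := γ) x
    have hy := powWeight_pos (s := s) (γ := γ) y
    have ht := abs_nonneg (t - 1)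
    calc _ ≤ B * powWeight s γ x * powWeight s γ y * |t - 1| := this
      _ ≤ (A + B) * powWeight s γ x * powWeight s γ y * |t - 1| := by gcongr
      _ = _ := by ring
  · have := hasDerivAt_cutK_dilate (s := s) hF one_pos x y
    simpa only [one_mul] using this

/-- An operator with a smooth kernel is of trace class. -/
theorem IsKerOp.hasTrace_cutK (hs : 0 < s) (hβ : 0 ≤ β) (hβ' : β < 1 / 2) (hF : SmoothQ F)
    (h : EulerBound (2 * s) β 1 F) {T : L2 s →L[ℂ] L2 s}
    (hT : IsKerOp (volume.restrict (Ioo 0 s)) (cutK s F) T) :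
    HasTrace T (ktr (volume.restrict (Ioo 0 s)) (cutK s F)) := by
  -- This γ solves (1 - 2γ) + β = γ, and β < 1/2 places it strictly between β and 1/2.
  obtain ⟨γ, hγ⟩ : ∃ γ, γ = (1 + β) / 3 := ⟨_, rfl⟩
  have hγ2 : γ < 1 / 2 := by linarith
  have hγ0 : 0 < γ := by linarith
  have hβγ : β ≤ γ := by linarith
  have hw := isWeight_powWeight hs hγ2
  obtain ⟨B, hB0, hB⟩ := h.exists_bound 1 le_rfl
  obtain ⟨A, hA0, hA⟩ := (h.mono_exponent hβγ).exists_bound 0 (by omega)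
  have hsS : ∀ {x}, x ∈ Ioo 0 s → x ∈ Ioo 0 (2 * s) := fun hx => ⟨hx.1, by linarith [hx.1, hx.2]⟩
  have hspow : ∀ x ∈ Ioo 0 s, s ^ (-γ) ≤ x ^ (-γ) := fun x hx =>
    Real.rpow_le_rpow_of_nonpos hx.1 hx.2.le (by linarith)
  have hs0 : 0 < s ^ (-γ) := Real.rpow_pos_of_pos hs _
  -- The factorization of F(x,y) = F(s,y) - ∫ₓˢ t⁻¹ (t∂ₜF)(t,y) dt. The constant 1/s averages over
  -- (0,s) to reproduce F(s,y). In the integral, t⁻¹ is split as t^(-2γ) t^(-(1-2γ)): for x < t the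
  -- first factor is at most x^(-γ) t^(-γ), and the second times t^(-β) equals t^(-γ).
  set P₁ := cutK s fun _ _ => ((s⁻¹ : ℝ) : ℂ)
  set Q₁ := cutK s fun _ y => F s y
  set P := cutK s fun x t => if x < t then ((t ^ (-(2 * γ)) : ℝ) : ℂ) else 0
  set Q := cutK s fun t y => ((t ^ (-(1 - 2 * γ)) : ℝ) : ℂ) * eulerX F t y
  have hP₁ : IsKer (powWeight s γ) P₁ := by
    refine (dominated_cutK (C := s⁻¹ / (s ^ (-γ) * s ^ (-γ))) (measurable_cutK measurable_const)
      (by positivity) fun x hx y hy => ?_).isKer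
    have h1 := hspow x hx
    have h2 := hspow y hy
    have h3 := Real.rpow_nonneg hx.1.le (-γ)
    rw [Complex.norm_real, Real.norm_of_nonneg (by positivity)]
    calc s⁻¹ = s⁻¹ / (s ^ (-γ) * s ^ (-γ)) * s ^ (-γ) * s ^ (-γ) := by field_simp
      _ ≤ _ := by gcongr
  have hQ₁ : IsKer (powWeight s γ) Q₁ := by
    refine (dominated_cutK (C := A) (measurable_cutK_of_continuousOn ?_) hA0
      fun x hx y hy => ?_).isKer
    · exact (ContDiffOn.continuousOn hF).comp (f := fun p : ℝ × ℝ => (s, p.2)) (by fun_prop)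
        fun p hp => ⟨hs, hp.2.1⟩
    -- The endpoint s is an interior point of (0,2s), so the bound covers it.
    · refine (hA s ⟨hs, by linarith⟩ y (hsS hy)).trans ?_
      have h1 := hspow x hx
      have h2 := Real.rpow_nonneg hy.1.le (-γ)
      gcongr
  have hP : IsKer (powWeight s γ) P := by
    refine (dominated_cutK (C := 1) (measurable_cutK ?_) one_pos fun x hx y hy => ?_).isKer
    · refine Measurable.ite (measurableSet_lt measurable_fst measurable_snd) ?_ measurable_const
      exact Complex.measurable_ofReal.comp (by fun_prop)
    · have h1 := Real.rpow_nonneg hx.1.le (-γ)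
      have h2 := Real.rpow_nonneg hy.1.le (-γ)
      split_ifs with hxy
      · rw [Complex.norm_real, Real.norm_of_nonneg (Real.rpow_nonneg hy.1.le _), one_mul]
        have h3 : y ^ (-γ) ≤ x ^ (-γ) :=
          Real.rpow_le_rpow_of_nonpos hx.1 hxy.le (by linarith)
        calc y ^ (-(2 * γ)) = y ^ (-γ) * y ^ (-γ) := by
              rw [← Real.rpow_add hy.1]; congr 1; ring
          _ ≤ _ := by gcongr
      · rw [norm_zero]; positivity
  have hQ : IsKer (powWeight s γ) Q := by
    refine (dominated_cutK (C := B * s ^ (γ - β)) (measurable_cutK_of_continuousOn ?_)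
      (by positivity) fun x hx y hy => ?_).isKer
    · refine ContinuousOn.mul ?_ ((ContDiffOn.continuousOn hF.eulerX).mono
        fun p hp => ⟨hp.1.1, hp.2.1⟩)
      refine Complex.continuous_ofReal.comp_continuousOn ?_
      exact continuousOn_fst.rpow_const fun p hp => Or.inl hp.1.1.ne'
    · rw [norm_mul, Complex.norm_real, Real.norm_of_nonneg (Real.rpow_nonneg hx.1.le _)]
      have h1 := hB x (hsS hx) y (hsS hy)
      have h2 := rpow_neg_le_mul_rpow_neg hy.1 hy.2.le hβγ
      have h3 := Real.rpow_nonneg hx.1.le (-(1 - 2 * γ))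
      have h4 := Real.rpow_nonneg hx.1.le (-β)
      have e : x ^ (-(1 - 2 * γ)) * x ^ (-β) = x ^ (-γ) := by
        rw [← Real.rpow_add hx.1]; congr 1; rw [hγ]; ring
      calc _ ≤ x ^ (-(1 - 2 * γ)) * (B * x ^ (-β) * (s ^ (γ - β) * y ^ (-γ))) := by
            gcongr
            exact h1.trans (by gcongr)
        _ = B * s ^ (γ - β) * (x ^ (-(1 - 2 * γ)) * x ^ (-β)) * y ^ (-γ) := by ring
        _ = _ := by rw [e]
  have hdec : cutK s F = kcomp (volume.restrict (Ioo 0 s)) P₁ Q₁ -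
      kcomp (volume.restrict (Ioo 0 s)) P Q := by
    ext x y
    rw [Pi.sub_apply, Pi.sub_apply]
    by_cases hxy : x ∈ Ioo 0 s ∧ y ∈ Ioo 0 s
    · obtain ⟨hx, hy⟩ := hxy
      have e1 : kcomp (volume.restrict (Ioo 0 s)) P₁ Q₁ x y = F s y := by
        have : ∀ u ∈ Ioo 0 s, P₁ x u * Q₁ u y = ((s⁻¹ : ℝ) : ℂ) * F s y := fun u hu => by
          simp only [P₁, Q₁, cutK_of_mem hx hu, cutK_of_mem hu hy]
        rw [kcomp, setIntegral_congr_fun measurableSet_Ioo this, setIntegral_const,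
          Real.volume_real_Ioo_of_le hs.le, sub_zero, Complex.real_smul, ← mul_assoc,
          ← Complex.ofReal_mul, mul_inv_cancel₀ hs.ne', Complex.ofReal_one, one_mul]
      have e2 : kcomp (volume.restrict (Ioo 0 s)) P Q x y =
          ∫ t in x..s, ((t⁻¹ : ℝ) : ℂ) * eulerX F t y := by
        have : ∀ u ∈ Ioo 0 s, P x u * Q u y =
            (Ioo x s).indicator (fun t => ((t⁻¹ : ℝ) : ℂ) * eulerX F t y) u := fun u hu => by
          simp only [P, Q, cutK_of_mem hx hu, cutK_of_mem hu hy]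
          by_cases hxu : x < u
          · rw [if_pos hxu, indicator_of_mem (show u ∈ Ioo x s from ⟨hxu, hu.2⟩), ← mul_assoc,
              ← Complex.ofReal_mul, ← Real.rpow_add hu.1]
            congr 2
            rw [← Real.rpow_neg_one]; congr 1; ring
          · rw [if_neg hxu, indicator_of_notMem (fun hm => hxu hm.1), zero_mul]
        rw [kcomp, setIntegral_congr_fun measurableSet_Ioo this,
          setIntegral_indicator measurableSet_Ioo,
          inter_eq_self_of_subset_right (Ioo_subset_Ioo_left hx.1.le),
          intervalIntegral.integral_of_le hx.2.le, integral_Ioc_eq_integral_Ioo]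
      rw [e1, e2, cutK_of_mem hx hy]
      exact hF.integral_eulerX hx.1 hx.2.le hy.1
    · rw [cutK_of_notMem hxy]
      have hz : ∀ A B : ℝ → ℝ → ℂ,
          kcomp (volume.restrict (Ioo 0 s)) (cutK s A) (cutK s B) x y = 0 := by
        intro A B
        rw [kcomp, integral_eq_zero_of_ae]
        refine .of_forall fun u => ?_
        rcases not_and_or.1 hxy with hx | hy
        · simp only [cutK_of_notMem fun h : x ∈ Ioo 0 s ∧ u ∈ Ioo 0 s => hx h.1, zero_mul,
            Pi.zero_apply]
        · simp only [cutK_of_notMem fun h : u ∈ Ioo 0 s ∧ y ∈ Ioo 0 s => hy h.2, mul_zero,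
            Pi.zero_apply]
      rw [hz, hz, sub_zero]
  obtain ⟨TP₁, hTP₁⟩ := exists_isKerOp hw hP₁
  obtain ⟨TQ₁, hTQ₁⟩ := exists_isKerOp hw hQ₁
  obtain ⟨TP, hTP⟩ := exists_isKerOp hw hP
  obtain ⟨TQ, hTQ⟩ := exists_isKerOp hw hQ
  have hop := (hTP₁.mul hw hP₁ hQ₁ hTQ₁).sub hw (hP₁.kcomp hw hQ₁) (hP.kcomp hw hQ)
    (hTP.mul hw hP hQ hTQ)
  rw [← hdec] at hop
  rw [hT.unique hop, hdec, ktr_sub hw (hP₁.kcomp hw hQ₁) (hP.kcomp hw hQ)]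
  -- Finiteness of the exponent gives the separability of L²(0,s).
  have : Fact ((2 : ENNReal) ≠ ⊤) := ⟨by simp⟩
  exact (hTP₁.hasTrace_mul hw hP₁ hQ₁ hTQ₁).sub (hTP.hasTrace_mul hw hP hQ hTQ)

theorem IsKerOp.isIntegralOperator (hs : 0 < s) (hγ : γ < 1 / 2)
    (hF : IsKer (powWeight s γ) (cutK s F)) {T : L2 s →L[ℂ] L2 s}
    (hT : IsKerOp (volume.restrict (Ioo 0 s)) (cutK s F) T) : IsIntegralOperator F s T := by
  obtain ⟨C, hF⟩ := hF
  intro f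
  filter_upwards [hT f, ae_restrict_mem measurableSet_Ioo] with x hx hxs
  have he : ∀ y ∈ Ioo 0 s, cutK s F x y * f y = F x y * f y := fun y hy => by
    rw [cutK_of_mem hxs hy]
  constructor
  · have := hF.integrable_mul (isWeight_powWeight hs hγ) x f
    exact IntegrableOn.congr_fun this he measurableSet_Ioo
  · rw [hx]
    exact setIntegral_congr_fun measurableSet_Ioo he

open scoped Pointwise in
/-- The Fredholm determinant on `(0,ts)` as a determinant on `(0,s)`. -/
theorem fredholmDet_mul (F : ℝ → ℝ → ℂ) (s : ℝ) {t : ℝ} (ht : 0 < t) :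
    fredholmDet F (t * s) = fredDet (volume.restrict (Ioo 0 s)) (cutK s (dilate F t)) := by
  rw [fredholmDet, fredDet]
  congr 1
  ext n
  congr 1
  have hset : (univ.pi fun _ : Fin n => Ioo (0 : ℝ) (t * s)) =
      t • (univ.pi fun _ : Fin n => Ioo (0 : ℝ) s) := by
    ext z
    rw [mem_smul_set_iff_inv_smul_mem₀ ht.ne']
    simp only [mem_univ_pi, Pi.smul_apply, smul_eq_mul, mem_Ioo]
    refine forall_congr' fun i => ?_
    rw [inv_mul_lt_iff₀ ht, mul_pos_iff_of_pos_left (inv_pos.2 ht)]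
  have hpi : (Measure.pi fun _ : Fin n => volume.restrict (Ioo (0 : ℝ) s)) =
      volume.restrict (univ.pi fun _ : Fin n => Ioo (0 : ℝ) s) := by
    rw [volume_pi, Measure.restrict_pi_pi]
  -- The Jacobian t^n of the substitution is cancelled by the factor t in each of the n rows of the
  -- dilated kernel matrix.
  have hscale := Measure.setIntegral_comp_smul_of_pos (volume : Measure (Fin n → ℝ))
    (fun z => (Matrix.of (fun i j : Fin n => F (z i) (z j))).det)
    (univ.pi fun _ : Fin n => Ioo (0 : ℝ) s) ht
  rw [← hset, Module.finrank_fin_fun] at hscale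
  have htn : (t : ℂ) ^ n ≠ 0 := pow_ne_zero _ (by exact_mod_cast ht.ne')
  have hdet : ∀ z ∈ (univ.pi fun _ : Fin n => Ioo (0 : ℝ) s),
      (kerMat (cutK s (dilate F t)) z).det =
        (t : ℂ) ^ n * (Matrix.of (fun i j : Fin n => F ((t • z) i) ((t • z) j))).det := by
    intro z hz
    have : kerMat (cutK s (dilate F t)) z =
        (t : ℂ) • Matrix.of (fun i j : Fin n => F ((t • z) i) ((t • z) j)) := by
      ext i j
      rw [kerMat, Matrix.of_apply, cutK_of_mem (hz i trivial) (hz j trivial)]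
      rfl
    rw [this, Matrix.det_smul, Fintype.card_fin]
  rw [detInt, hpi, setIntegral_congr_fun (MeasurableSet.univ_pi fun _ => measurableSet_Ioo) hdet,
    integral_const_mul, hscale, Complex.real_smul]
  push_cast
  rw [mul_inv_cancel_left₀ htn]

end DerivedKernel

/-! ### The resolvent kernel and the logarithmic derivative -/

namespace DerivedKernel

section Resolvent

variable {X : Type*} [MeasurableSpace X] {ν : Measure X} {w : X → ℝ} {C : ℝ} {K H : X → X → ℂ}

/-- The resolvent kernel, as the quotient of the first Fredholm minor by the determinant. -/
def resolventKer (ν : Measure X) (K : X → X → ℂ) (x y : X) : ℂ :=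
  fredMinor ν K K x y / fredDet ν K

theorem kcomp_div_right (c : ℂ) (K L : X → X → ℂ) (x y : X) :
    kcomp ν K (fun x y => L x y / c) x y = kcomp ν K L x y / c := by
  simp only [kcomp, ← mul_div_assoc, integral_div]

theorem kcomp_div_left (c : ℂ) (K L : X → X → ℂ) (x y : X) :
    kcomp ν (fun x y => K x y / c) L x y = kcomp ν K L x y / c := by
  simp only [kcomp, div_mul_eq_mul_div, integral_div]

variable [SigmaFinite ν]

/-- The lower bound b is a separate parameter so that one constant can serve for all nearby values
of t. -/
theorem resolventKer_dominated (hw : IsWeight ν w) (hK : Dominated w C K) {b : ℝ} (hb : 0 < b)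
    (hd : b ≤ ‖fredDet ν K‖) :
    Dominated w ((minorConst C (∫ x, w x ^ 2 ∂ν) + 1) / b) (resolventKer ν K) where
  pos := div_pos (fredMinor_dominated hw hK hK).pos hb
  measurable := (fredMinor_dominated hw hK hK).measurable.div_const _
  bound x y := by
    have h := (fredMinor_dominated hw hK hK).bound x y
    rw [resolventKer, norm_div, div_mul_eq_mul_div, div_mul_eq_mul_div]
    exact div_le_div₀ ((norm_nonneg _).trans h) h hb hd

theorem resolventKer_eq (hw : IsWeight ν w) (hK : Dominated w C K) (hd : fredDet ν K ≠ 0) :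
    resolventKer ν K = K + kcomp ν K (resolventKer ν K) := by
  ext x y
  change fredMinor ν K K x y / fredDet ν K =
    K x y + kcomp ν K (fun x y => fredMinor ν K K x y / fredDet ν K) x y
  rw [kcomp_div_right, fredMinor_eq hw hK hK]
  field_simp

theorem resolventKer_eq' (hw : IsWeight ν w) (hK : Dominated w C K) (hd : fredDet ν K ≠ 0) :
    resolventKer ν K = K + kcomp ν (resolventKer ν K) K := by
  ext x y
  change fredMinor ν K K x y / fredDet ν K =
    K x y + kcomp ν (fun x y => fredMinor ν K K x y / fredDet ν K) K x y
  rw [kcomp_div_left, fredMinor_eq' hw hK]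
  field_simp

/-- Substituting fredMinor K K = det · R into the integral equation gives the minor as det · H(1 +
R). -/
theorem ktr_fredMinor (hw : IsWeight ν w) (hH : Dominated w C H) (hK : Dominated w C K)
    (hd : fredDet ν K ≠ 0) : ktr ν (fredMinor ν H K) =
      fredDet ν K * (ktr ν H + ktr ν (kcomp ν H (resolventKer ν K))) := by
  have hR := resolventKer_dominated hw hK (norm_pos_iff.2 hd) le_rfl
  have h1 : ∀ x y, fredMinor ν H K x y =
      fredDet ν K * (H + kcomp ν H (resolventKer ν K)) x y := by
    intro x y
    change _ = fredDet ν K *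
      (H x y + kcomp ν H (fun x y => fredMinor ν K K x y / fredDet ν K) x y)
    rw [kcomp_div_right, fredMinor_eq hw hH hK]
    field_simp
  rw [← ktr_add hw hH.isKer (hH.isKer.kcomp hw hR.isKer), ktr, ktr, ← integral_const_mul]
  simp only [h1]

/-- The operator with the resolvent kernel inverts `1 - A`. -/
theorem isUnit_and_inverse (hw : IsWeight ν w) (hK : Dominated w C K) (hd : fredDet ν K ≠ 0)
    {A R : Lp ℂ 2 ν →L[ℂ] Lp ℂ 2 ν} (hA : IsKerOp ν K A) (hR : IsKerOp ν (resolventKer ν K) R) :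
    IsUnit (1 - A) ∧ Ring.inverse (1 - A) = 1 + R := by
  have hRk := (resolventKer_dominated hw hK (norm_pos_iff.2 hd) le_rfl).isKer
  have h1 : R = A + A * R := by
    refine hR.unique ?_
    rw [resolventKer_eq hw hK hd]
    exact hA.add hw hK.isKer (hK.isKer.kcomp hw hRk) (hA.mul hw hK.isKer hRk hR)
  have h2 : R = A + R * A := by
    refine hR.unique ?_
    rw [resolventKer_eq' hw hK hd]
    exact hA.add hw hK.isKer (hRk.kcomp hw hK.isKer) (hR.mul hw hRk hK.isKer hA)
  have e1 : (1 - A) * (1 + R) = 1 := by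
    have : (1 - A) * (1 + R) = 1 + R - (A + A * R) := by noncomm_ring
    rw [this, ← h1, add_sub_cancel_right]
  have e2 : (1 + R) * (1 - A) = 1 := by
    have : (1 + R) * (1 - A) = 1 + R - (A + R * A) := by noncomm_ring
    rw [this, ← h2, add_sub_cancel_right]
  let U : (Lp ℂ 2 ν →L[ℂ] Lp ℂ 2 ν)ˣ := ⟨1 - A, 1 + R, e1, e2⟩
  exact ⟨U.isUnit, Ring.inverse_unit U⟩

end Resolvent

/-- Passes from the dilation parameter to the endpoint ts, whence the division by s. A derivative of
a real-valued function is real, so no information is lost in taking the real part. -/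
theorem hasDerivAt_of_ofReal_eq {f : ℝ → ℝ} {c : ℝ → ℂ} {D : ℂ} {s t : ℝ} (hs : s ≠ 0)
    (hf : ∀ᶠ t in nhds t, (f (t * s) : ℂ) = c t) (hc : HasDerivAt c D t) :
    HasDerivAt f (D.re / s) (t * s) ∧ ((D.re : ℝ) : ℂ) = D := by
  have h1 : HasDerivAt (fun t => f (t * s)) D.re t := by
    refine (Complex.reCLM.hasFDerivAt.comp_hasDerivAt t hc).congr_of_eventuallyEq ?_
    filter_upwards [hf] with t ht
    simp [← ht]
  constructor
  · have h2 : HasDerivAt (fun u : ℝ => u / s) (1 / s) (t * s) := (hasDerivAt_id _).div_const s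
    have h3 : HasDerivAt (fun t => f (t * s)) D.re (t * s / s) := by
      rwa [mul_div_cancel_right₀ _ hs]
    have h4 := h3.comp (t * s) h2
    have h5 : (fun t => f (t * s)) ∘ (fun u : ℝ => u / s) = f := by
      ext u; simp [div_mul_cancel₀ _ hs]
    rw [h5] at h4
    exact h4.congr_deriv (by ring)
  · exact h1.ofReal_comp.unique (hc.congr_of_eventuallyEq hf)

/-- The trace formula for the logarithmic derivative, on all of `(0,s)²`. -/
def traceV (s : ℝ) (K : ℝ → ℝ → ℂ) (t : ℝ) : ℂ :=
  ktr (volume.restrict (Ioo 0 s)) (cutK s (dilate (derived K) t)) +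
    ktr (volume.restrict (Ioo 0 s)) (kcomp (volume.restrict (Ioo 0 s))
      (cutK s (dilate (derived K) t))
      (resolventKer (volume.restrict (Ioo 0 s)) (cutK s (dilate K t))))

theorem ktr_const_mul {X : Type*} [MeasurableSpace X] {ν : Measure X} (c : ℂ) (K : X → X → ℂ) :
    ktr ν (fun x y => c * K x y) = c * ktr ν K := integral_const_mul _ _

theorem cutK_dilate (s : ℝ) (F : ℝ → ℝ → ℂ) (t : ℝ) :
    cutK s (dilate F t) = fun x y => (t : ℂ) * cutK s (fun x y => F (t * x) (t * y)) x y := by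
  ext x y
  simp only [cutK, dilate]
  split_ifs <;> simp

theorem kcomp_const_mul {X : Type*} [MeasurableSpace X] {ν : Measure X} (c : ℂ)
    (K L : X → X → ℂ) :
    kcomp ν (fun x y => c * K x y) L = fun x y => c * kcomp ν K L x y := by
  ext x y
  simp only [kcomp, mul_assoc, integral_const_mul]

/-- The logarithmic derivative of the Fredholm determinant. -/
theorem hasDerivAt_det_and_auxV {K : ℝ → ℝ → ℂ} {s γ : ℝ} (hs : 0 < s) (hγ : 0 ≤ γ)
    (hγ2 : γ < 1 / 2) (hK : SmoothQ K) (hb : EulerBound (2 * s) γ 1 K) {g : ℝ → ℝ}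
    (hg : ∀ s : ℝ, 0 < s → fredholmDet K s = (g s : ℂ)) (hpos : ∀ s : ℝ, 0 < s → 0 < g s)
    {t : ℝ} (ht : t ∈ Ioo (1 / 2 : ℝ) 2) :
    DifferentiableAt ℝ g (t * s) ∧ (auxV g (t * s) : ℂ) = traceV s K t := by
  have hw := isWeight_powWeight hs hγ2
  have ht0 : ∀ t ∈ Ioo (1 / 2 : ℝ) 2, 0 < t := fun t ht => by linarith [ht.1]
  obtain ⟨A, hA⟩ := dominated_dilation hγ hK fun i j hij => hb i j (by omega)
  obtain ⟨B, hB⟩ := dominated_dilation hγ hK.derived (hb.derived hK)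
  have hA0 := (hA t ht).1.pos
  have hB0 := (hB t ht).1.pos
  have hA' : ∀ t ∈ Ioo (1 / 2 : ℝ) 2, Dominated (powWeight s γ) (A + B) (cutK s (dilate K t)) :=
    fun t ht => (hA t ht).2.mono powWeight_pos (by linarith)
  have hB' : ∀ t ∈ Ioo (1 / 2 : ℝ) 2, Dominated (powWeight s γ) (A + B)
      (cutK s fun x y => derived K (t * x) (t * y)) :=
    fun t ht => (hB t ht).1.mono powWeight_pos (by linarith)
  have hd := hasDerivAt_fredDet hw isOpen_Ioo isPreconnected_Ioo hA' hB'
    (fun t ht x y => hasDerivAt_cutK_dilate hK (ht0 t ht) x y) ht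
  have hdet : ∀ t ∈ Ioo (1 / 2 : ℝ) 2, (g (t * s) : ℂ) =
      fredDet (volume.restrict (Ioo 0 s)) (cutK s (dilate K t)) := fun t ht => by
    rw [← hg _ (mul_pos (ht0 t ht) hs), fredholmDet_mul K s (ht0 t ht)]
  have hgt := hpos _ (mul_pos (ht0 t ht) hs)
  have hgt' : (g (t * s) : ℂ) ≠ 0 := by exact_mod_cast hgt.ne'
  have hD := ktr_fredMinor hw (hB' t ht) (hA' t ht) (by rw [← hdet t ht]; exact hgt')
  rw [hD, ← hdet t ht] at hd
  -- The velocity of the dilated family is K'(tx,ty), without the factor t of the dilation of K'.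
  -- The missing t comes from the prefactor ts in -ts g'(ts)/g(ts), whose s is used up by the chain
  -- rule.
  have hV : traceV s K t = t * (ktr (volume.restrict (Ioo 0 s))
      (cutK s fun x y => derived K (t * x) (t * y)) + ktr (volume.restrict (Ioo 0 s))
      (kcomp (volume.restrict (Ioo 0 s)) (cutK s fun x y => derived K (t * x) (t * y))
        (resolventKer (volume.restrict (Ioo 0 s)) (cutK s (dilate K t))))) := by
    rw [traceV, cutK_dilate s (derived K), ktr_const_mul, kcomp_const_mul, ktr_const_mul, mul_add]
  rw [hV]
  generalize ktr (volume.restrict (Ioo 0 s)) _ + ktr (volume.restrict (Ioo 0 s)) _ = V at hd ⊢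
  obtain ⟨h1, h2⟩ := hasDerivAt_of_ofReal_eq hs.ne'
    (Filter.eventually_of_mem (isOpen_Ioo.mem_nhds ht) hdet) hd
  refine ⟨h1.differentiableAt, ?_⟩
  rw [auxV, (h1.log hgt.ne').deriv]
  have hs' : (s : ℂ) ≠ 0 := by exact_mod_cast hs.ne'
  simp only [Complex.ofReal_mul, Complex.ofReal_neg, Complex.ofReal_div, h2]
  field_simp

theorem IsSmoothKernel.exists_eulerBound {K : ℝ → ℝ → ℂ} (hK : IsSmoothKernel K) {s : ℝ}
    (hs : 0 < s) : ∃ β, 0 ≤ β ∧ β < 1 / 2 ∧ EulerBound (2 * s) β 3 K := by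
  obtain ⟨β, hβ, hb⟩ := hK.bound (2 * s) (by positivity)
  have h : EulerBound (2 * s) β 3 K := hb
  exact ⟨max β 0, le_max_right _ _, max_lt hβ (by norm_num), h.mono_exponent (le_max_left _ _)⟩

theorem EulerBound.mono_order {S β : ℝ} {k l : ℕ} {F : ℝ → ℝ → ℂ} (h : EulerBound S β k F)
    (hl : l ≤ k) : EulerBound S β l F := fun i j hij => h i j (hij.trans hl)

/-- The derivative of the trace formula. -/
theorem hasDerivAt_traceV {K : ℝ → ℝ → ℂ} {s γ : ℝ} (hs : 0 < s) (hγ : 0 ≤ γ)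
    (hγ2 : γ < 1 / 2) (hK : SmoothQ K) (hb : EulerBound (2 * s) γ 2 K)
    {ν : Measure ℝ} (hν : ν = volume.restrict (Ioo 0 s))
    (hcont : ContinuousAt (fun t => fredDet ν (cutK s (dilate K t))) 1)
    (hne : fredDet ν (cutK s K) ≠ 0) :
    IsKer (powWeight s γ) (cutK s (derived (derived K))) ∧
    HasDerivAt (traceV s K)
      (ktr ν (cutK s (derived (derived K))) +
        (ktr ν (kcomp ν (cutK s (derived (derived K))) (resolventKer ν (cutK s K))) +
        ktr ν (kcomp ν (cutK s (derived K))
          ((cutK s (derived K) + kcomp ν (cutK s (derived K)) (resolventKer ν (cutK s K))) +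
            kcomp ν (resolventKer ν (cutK s K))
              (cutK s (derived K) + kcomp ν (cutK s (derived K))
                (resolventKer ν (cutK s K))))))) 1 := by
  subst hν
  have hw := isWeight_powWeight hs hγ2
  obtain ⟨C, hC⟩ := kderiv_dilate hγ hK (hb.mono_order (by norm_num))
  obtain ⟨D, hD⟩ := kderiv_dilate hγ hK.derived (hb.derived hK)
  have hpos : 0 < ‖fredDet (volume.restrict (Ioo 0 s)) (cutK s K)‖ := norm_pos_iff.2 hne
  -- By continuity the determinant stays above half its modulus at t = 1, so the resolvent kernels
  -- are dominated with a common constant.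
  have hlow : ∀ᶠ t in nhds (1 : ℝ), ‖fredDet (volume.restrict (Ioo 0 s)) (cutK s K)‖ / 2 ≤
      ‖fredDet (volume.restrict (Ioo 0 s)) (cutK s (dilate K t))‖ := by
    refine (hcont.norm.eventually_const_lt ?_).mono fun t ht => le_of_lt ht
    change _ < ‖fredDet _ (cutK s (dilate K 1))‖
    rw [dilate_one]
    linarith
  have hne' : ∀ᶠ t in nhds (1 : ℝ),
      fredDet (volume.restrict (Ioo 0 s)) (cutK s (dilate K t)) ≠ 0 :=
    hlow.mono fun t ht => norm_pos_iff.1 (lt_of_lt_of_le (by positivity) ht)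
  obtain ⟨E, hE⟩ := KDeriv.resolvent hw hC
    (R := fun t => resolventKer (volume.restrict (Ioo 0 s)) (cutK s (dilate K t)))
    (by
      filter_upwards [hC.dominated, hlow] with t h1 h2
      exact resolventKer_dominated hw h1 (by positivity) h2)
    (by
      filter_upwards [hC.dominated, hne'] with t h1 h2
      exact resolventKer_eq hw h1 h2)
    (by
      filter_upwards [hC.dominated, hne'] with t h1 h2
      exact resolventKer_eq' hw h1 h2)
  have h1 := hD.hasDerivAt_ktr hw
  have h2 := (hD.kcomp hw hE).hasDerivAt_ktr hw
  refine ⟨hD.dominated'.isKer, ?_⟩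
  simp only [dilate_one] at h2 hE
  have hRk := hE.dominated.self_of_nhds.isKer
  have hlk := hD.dominated.self_of_nhds.isKer
  rw [dilate_one] at hRk hlk
  rw [ktr_add hw (hD.dominated'.isKer.kcomp hw hRk) (hlk.kcomp hw hE.dominated'.isKer)] at h2
  exact h1.add h2

end DerivedKernel

end

/-! ### The two trace formulas -/

theorem mainTheorem6 (K : ℝ → ℝ → ℂ) (hK : DerivedKernel.IsSmoothKernel K)
    (g : ℝ → ℝ) (hg : ∀ s : ℝ, 0 < s → DerivedKernel.fredholmDet K s = (g s : ℂ))
    (hpos : ∀ s : ℝ, 0 < s → 0 < g s) (s : ℝ) (hs : 0 < s) :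
    DifferentiableAt ℝ g s ∧ DifferentiableAt ℝ (DerivedKernel.auxV g) s ∧
    ∃ A A' A'' : DerivedKernel.L2 s →L[ℂ] DerivedKernel.L2 s,
      DerivedKernel.IsIntegralOperator K s A ∧
      DerivedKernel.IsIntegralOperator (DerivedKernel.derived K) s A' ∧
      DerivedKernel.IsIntegralOperator (DerivedKernel.derived (DerivedKernel.derived K)) s A'' ∧
      IsUnit (1 - A) ∧
      DerivedKernel.HasTrace (Ring.inverse (1 - A) * A') (DerivedKernel.auxV g s : ℂ) ∧
      DerivedKernel.HasTrace
        (Ring.inverse (1 - A) * A'' + (Ring.inverse (1 - A) * A') ^ 2)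
        (DerivedKernel.auxU g s : ℂ) := by
  open DerivedKernel in
  obtain ⟨β, hβ0, hβ, hb⟩ := hK.exists_eulerBound hs
  have hsm : SmoothQ K := hK.contDiffOn
  have hw := isWeight_powWeight hs hβ
  set ν := volume.restrict (Ioo (0 : ℝ) s) with hν
  have hmem : Ioo (1 / 2 : ℝ) 2 ∈ nhds (1 : ℝ) := Ioo_mem_nhds (by norm_num) (by norm_num)
  have hV := fun t ht => hasDerivAt_det_and_auxV hs hβ0 hβ hsm (hb.mono_order (by norm_num)) hg
    hpos (t := t) ht
  have h1 := hV 1 (mem_of_mem_nhds hmem)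
  rw [one_mul] at h1
  have hdet : ∀ t : ℝ, 0 < t → fredDet ν (cutK s (dilate K t)) = (g (t * s) : ℂ) := fun t ht => by
    rw [← fredholmDet_mul K s ht, hg _ (mul_pos ht hs)]
  have hdet1 : fredDet ν (cutK s K) = (g s : ℂ) := by
    have := hdet 1 one_pos
    rwa [dilate_one, one_mul] at this
  have hne : fredDet ν (cutK s K) ≠ 0 := by
    rw [hdet1]; exact_mod_cast (hpos s hs).ne'
  have hcont : ContinuousAt (fun t => fredDet ν (cutK s (dilate K t))) 1 := by
    have hg1 : ContinuousAt g (1 * s) := by rw [one_mul]; exact h1.1.continuousAt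
    have hg2 : ContinuousAt (fun t : ℝ => g (t * s)) 1 :=
      ContinuousAt.comp (f := fun t : ℝ => t * s) hg1 (by fun_prop)
    refine (Complex.continuous_ofReal.continuousAt.comp hg2).congr ?_
    filter_upwards [Ioi_mem_nhds one_pos] with t ht using (hdet t ht).symm
  obtain ⟨hk'', hder⟩ := hasDerivAt_traceV hs hβ0 hβ hsm (hb.mono_order (by norm_num)) hν hcont hne
  obtain ⟨hv, hre⟩ := hasDerivAt_of_ofReal_eq hs.ne'
    (Filter.eventually_of_mem hmem fun t ht => (hV t ht).2) hder
  rw [one_mul] at hv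
  obtain ⟨C, hC⟩ := kderiv_dilate hβ0 hsm (hb.mono_order (by norm_num))
  have hk : Dominated (powWeight s β) C (cutK s K) := by
    simpa only [dilate_one] using hC.dominated.self_of_nhds
  have hk' := hC.dominated'.isKer
  have hRk := (resolventKer_dominated hw hk (norm_pos_iff.2 hne) le_rfl).isKer
  obtain ⟨A, hA⟩ := exists_isKerOp hw hk.isKer
  obtain ⟨A', hA'⟩ := exists_isKerOp hw hk'
  obtain ⟨A'', hA''⟩ := exists_isKerOp hw hk''
  obtain ⟨R, hR⟩ := exists_isKerOp hw hRk
  obtain ⟨hunit, hinv⟩ := isUnit_and_inverse hw hk hne hA hR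
  have htr' := hA'.hasTrace_cutK hs hβ0 hβ hsm.derived (EulerBound.derived hsm
    (hb.mono_order (by norm_num)))
  -- All three orders are used here: two for the second derived kernel, one for its trace.
  have htr'' := hA''.hasTrace_cutK hs hβ0 hβ hsm.derived.derived
    (EulerBound.derived hsm.derived (EulerBound.derived hsm hb))
  have : Fact ((2 : ENNReal) ≠ ⊤) := ⟨by simp⟩
  refine ⟨h1.1, hv.differentiableAt, A, A', A'', hA.isIntegralOperator hs hβ hk.isKer,
    hA'.isIntegralOperator hs hβ hk', hA''.isIntegralOperator hs hβ hk'', hunit, ?_, ?_⟩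
  -- In (1 + R)A' = A' + RA' the first term has a trace because its kernel is smooth, the second as
  -- a product of two dominated kernels.
  · have e : Ring.inverse (1 - A) * A' = A' + R * A' := by rw [hinv]; noncomm_ring
    rw [e, h1.2, traceV, dilate_one, dilate_one, ktr_kcomp_comm hw hk' hRk]
    exact htr'.add (hR.hasTrace_mul hw hRk hk' hA')
  · have hS := hA'.add hw hk' (hk'.kcomp hw hRk) (hA'.mul hw hk' hRk hR)
    have hSk := hk'.add (hk'.kcomp hw hRk)
    have hD := hS.add hw hSk (hRk.kcomp hw hSk) (hR.mul hw hRk hSk hS)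
    have hDk := hSk.add (hRk.kcomp hw hSk)
    -- The square is ((1 + R)A'(1 + R))A', whose left factor has as kernel the derivative of the
    -- resolvent kernel; cyclicity then matches the derivative of the trace formula.
    have e : Ring.inverse (1 - A) * A'' + (Ring.inverse (1 - A) * A') ^ 2 =
        A'' + (R * A'' + (A' + A' * R + R * (A' + A' * R)) * A') := by
      rw [hinv, sq]; noncomm_ring
    rw [e, auxU, hv.deriv, mul_div_cancel₀ _ hs.ne', hre, ktr_kcomp_comm hw hk'' hRk, ktr_kcomp_comm hw hk' hDk]
    exact htr''.add ((hR.hasTrace_mul hw hRk hk'' hA'').add (hD.hasTrace_mul hw hDk hk' hA'))
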